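/- Let $X$ be a metric space with more than one point that is uniformly perfect: there is $c\in(0,1)$ such that $B(x,R)\setminus B(x,cR)\neq\varnothing$ for all $x\in X$ and all $0<R<|X|$, where $|\cdot|$ denotes diameter and $B(x,R)$ is the open ball. Let $F\subseteq X$ be non-empty and totally bounded. For a totally bounded set $E\subseteq X$ let $N_\delta(E)$ be the least number of open balls of radius $\delta/2$ with centres in $E$ that cover $E$. Put $$\dim_{\mathrm A}F=\inf\{s:\exists C>0\ \forall x\in F\ \forall\, 0<r<R:\ N_r(B(x,R)\cap F)\le C(R/r)^s\},$$ $$\dim_{\mathrm L}F=\sup\{s:\exists C>0\ \forall x\in F\ \forall\, 0<r<R\le|F|:\ N_r(B(x,R)\cap F)\ge C(R/r)^s\}.$$ For $0<\theta<1$, let $\overline{\dim}_\theta F$ be the infimum of all $s\ge 0$ such that for every $\epsilon>0$ there is $\delta_0\in(0,1]$ such that for all $\delta\in(0,\delta_0)$ there is a finite or countable cover $\{U_i\}$ of $F$ by subsets of $X$ with $\delta^{1/\theta}\le|U_i|\le\delta$ for all $i$ and $\sum_i|U_i|^s\le\epsilon$. Let $\underline{\dim}_\theta F$ be the infimum of all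 $s\ge 0$ such that for every $\epsilon>0$ and every $\delta_0\in(0,1]$ such a cover exists for some $\delta\in(0,\delta_0)$. For $\theta=1$, let $\overline{\dim}_1F$ and $\underline{\dim}_1F$ be the upper and lower box dimensions, that is, the upper and lower limits of $\log N_\delta(F)/(-\log\delta)$ as $\delta\to0^+$. Write $\lambda=\dim_{\mathrm L}F$ and $\alpha=\dim_{\mathrm A}F$, and assume $\lambda<\alpha<\infty$. Let $h$ be either of the functions $\theta\mapsto\underline{\dim}_\theta F$ and $\theta\mapsto\overline{\dim}_\theta F$ on $(0,1]$. Then $\lambda\le h\le\alpha$ on $(0,1]$, and for all $0<\theta\le\phi\le1$, $$h(\theta)\le h(\phi)\le h(\theta)+\frac{(h(\theta)-\lambda)(\alpha-h(\theta))}{\phi(h(\theta)-\lambda)+\theta(\alpha-h(\theta))}(\phi-\theta).$$ Furthermore, $h$ is continuous on $(0,1]$, for every $\theta\in(0,1]$ it is Lipschitz on $[\theta,1]$ with Lipschitz constant $\frac{\alpha-\lambda}{4\theta}$, and $h$ is differentiable Lebesgue-almost everywhere on $(0,1)$. -/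

import Mathlib

open Set Filter Topology MeasureTheory

noncomputable section

/-- A metric space is uniformly perfect if for some `c ∈ (0,1)` we have
`B(x,R) \ B(x,cR) ≠ ∅` for every point `x` and every `0 < R < |X|`
(the diameter `|X|` may be infinite). -/
def IsUniformlyPerfect (X : Type*) [MetricSpace X] : Prop :=
  ∃ c : ℝ, 0 < c ∧ c < 1 ∧ ∀ (x : X) (R : ℝ), 0 < R →
    ENNReal.ofReal R < Metric.ediam (univ : Set X) →
      (Metric.ball x R \ Metric.ball x (c * R)).Nonempty

/-- `N_δ(E)`: the least `n` such that `E` is covered by `n` open balls of radius `δ/2` with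
centres in `E`. Such an `n` exists whenever `E` is totally bounded and `δ > 0`; the definition is
used only for such sets. -/
def ballCoveringNumber {X : Type*} [MetricSpace X] (δ : ℝ) (E : Set X) : ℕ :=
  sInf {n : ℕ | ∃ x : Fin n → X, (∀ i, x i ∈ E) ∧ E ⊆ ⋃ i, Metric.ball (x i) (δ / 2)}

/-- The Assouad dimension, as an extended real. -/
def assouadDim {X : Type*} [MetricSpace X] (F : Set X) : EReal :=
  sInf ((fun s : ℝ => (s : EReal)) '' {s : ℝ | ∃ C : ℝ, 0 < C ∧
    ∀ x ∈ F, ∀ r R : ℝ, 0 < r → r < R →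
      (ballCoveringNumber r (Metric.ball x R ∩ F) : ℝ) ≤ C * (R / r) ^ s})

/-- The lower dimension, as an extended real. -/
def lowerDim {X : Type*} [MetricSpace X] (F : Set X) : EReal :=
  sSup ((fun s : ℝ => (s : EReal)) '' {s : ℝ | ∃ C : ℝ, 0 < C ∧
    ∀ x ∈ F, ∀ r R : ℝ, 0 < r → r < R → R ≤ Metric.diam F →
      C * (R / r) ^ s ≤ (ballCoveringNumber r (Metric.ball x R ∩ F) : ℝ)})

/-- The upper box dimension. -/
def upperBoxDim {X : Type*} [MetricSpace X] (F : Set X) : EReal :=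
  limsup (fun δ : ℝ => ((Real.log (ballCoveringNumber δ F) / (-Real.log δ) : ℝ) : EReal))
    (𝓝[>] (0 : ℝ))

/-- The lower box dimension. -/
def lowerBoxDim {X : Type*} [MetricSpace X] (F : Set X) : EReal :=
  liminf (fun δ : ℝ => ((Real.log (ballCoveringNumber δ F) / (-Real.log δ) : ℝ) : EReal))
    (𝓝[>] (0 : ℝ))

/-- `F` has a finite or countable `(δ,θ)`-cover (by subsets `U` of the ambient space with
`δ^{1/θ} ≤ |U| ≤ δ`) whose `s`-cost `∑ |U|^s` is at most `ε`. For `0 < δ` the lower bound makes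
the diameter of every `U` positive; in particular every `U` is bounded, as the diameter of an
unbounded set is `0` here. -/
def HasCheapCover {X : Type*} [MetricSpace X] (F : Set X) (θ s δ ε : ℝ) : Prop :=
  ∃ 𝒰 : Set (Set X), 𝒰.Countable ∧ F ⊆ ⋃₀ 𝒰 ∧
    (∀ U ∈ 𝒰, δ ^ (1 / θ) ≤ Metric.diam U ∧ Metric.diam U ≤ δ) ∧
    ∑' U : 𝒰, ENNReal.ofReal (Metric.diam (U : Set X) ^ s) ≤ ENNReal.ofReal ε

open Classical in
/-- The upper `θ`-intermediate dimension, for `0 < θ ≤ 1`. At `θ = 1` it is the upper box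
dimension: a general metric space need not have any sets of diameter exactly `δ`. -/
def upperIntermediateDim {X : Type*} [MetricSpace X] (F : Set X) (θ : ℝ) : EReal :=
  if θ = 1 then upperBoxDim F
  else sInf ((fun s : ℝ => (s : EReal)) '' {s : ℝ | 0 ≤ s ∧ ∀ ε : ℝ, 0 < ε →
    ∃ δ₀ : ℝ, 0 < δ₀ ∧ δ₀ ≤ 1 ∧ ∀ δ : ℝ, 0 < δ → δ < δ₀ → HasCheapCover F θ s δ ε})

open Classical in
/-- The lower `θ`-intermediate dimension, for `0 < θ ≤ 1`. At `θ = 1` it is the lower box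
dimension. -/
def lowerIntermediateDim {X : Type*} [MetricSpace X] (F : Set X) (θ : ℝ) : EReal :=
  if θ = 1 then lowerBoxDim F
  else sInf ((fun s : ℝ => (s : EReal)) '' {s : ℝ | 0 ≤ s ∧ ∀ ε : ℝ, 0 < ε →
    ∀ δ₀ : ℝ, 0 < δ₀ → δ₀ ≤ 1 → ∃ δ : ℝ, 0 < δ ∧ δ < δ₀ ∧ HasCheapCover F θ s δ ε})

end

/-! Take a cover admissible for `θ` at scale `δ` with small `s`-cost. For `φ > θ` and some `t > s`
it is rebuilt into a cover admissible for `φ` at the finer scale `δ' = δ ^ β`, whose `t`-cost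
exceeds the old `s`-cost by at most a constant factor. Sets larger than `δ'` are subdivided. An
Assouad exponent `a` bounds the number of pieces, and the cost stays bounded if `β = (a - s) / (a -
t)`. Sets much smaller than `δ' ^ (1/φ)` are merged into balls of about that radius. A ball covered
by tiny sets already carries `p`-cost comparable to the `p`-th power of its radius, for `p` below
the lower dimension, so few such balls are needed. This is affordable when `φ (s - p) (a - t) ≤ θ (t
- p) (a - s)`. Letting `p → λ`, `a → α`, `s → h θ` and solving the equality for `t` gives the stated
bound. The carrying lemmas are `SplitsAtRatio.le_sum_diam_rpow`, `exists_ball_cover_of_cover`,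
`exists_ball_cover_of_hasCheapCover` and `IsIntermediateDim.le_of_exponents`.

The same `p`-cost estimate yields `λ ≤ h`, covers by equal balls yield `h ≤ α`, and uniform
perfectness makes the diameter of a ball comparable to its radius. The Lipschitz constant is the
AM-GM bound on the difference quotient; differentiability follows from monotonicity. -/

/-! ### Separated nets and covering numbers. -/

/-- A separated set of maximal cardinality works; the cardinality is bounded because a ball of
radius `r / 2` contains at most one of its points. -/
lemma exists_separated_net {X : Type*} [MetricSpace X] {E : Set X} (hE : TotallyBounded E)
    {r : ℝ} (hr : 0 < r) :
    ∃ A : Finset X, (A : Set X) ⊆ E ∧ (∀ x ∈ A, ∀ y ∈ A, x ≠ y → r ≤ dist x y) ∧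
      ∀ x ∈ E, ∃ y ∈ A, dist x y < r := by
  classical
  set S : Set ℕ := {n | ∃ A : Finset X, A.card = n ∧ (A : Set X) ⊆ E ∧
    ∀ x ∈ A, ∀ y ∈ A, x ≠ y → r ≤ dist x y} with hS
  obtain ⟨T, hT, hcov⟩ := Metric.totallyBounded_iff.1 hE (r / 2) (half_pos hr)
  have hbdd : BddAbove S := by
    refine ⟨hT.toFinset.card, ?_⟩
    rintro n ⟨A, rfl, hAE, hsep⟩
    have h1 : ∀ x ∈ A, ∃ y ∈ hT.toFinset, dist x y < r / 2 := by
      intro x hx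
      have := hcov (hAE hx)
      simp only [mem_iUnion, Metric.mem_ball] at this
      obtain ⟨y, hy, hd⟩ := this
      exact ⟨y, by simpa using hy, hd⟩
    choose! f hfT hfd using h1
    refine Finset.card_le_card_of_injOn f hfT ?_
    intro x hx y hy hxy
    by_contra hne
    have h2 := hsep x hx y hy hne
    have h3 := hfd x hx
    have h4 := hfd y hy
    rw [← hxy] at h4
    have := dist_triangle_right x y (f x)
    linarith
  have hne : S.Nonempty := ⟨0, ∅, by simp⟩
  obtain ⟨A, hcard, hAE, hsep⟩ := Nat.sSup_mem hne hbdd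
  refine ⟨A, hAE, hsep, ?_⟩
  intro x hx
  by_contra! hfar
  have hxA : x ∉ A := fun h => by
    have := hfar x h
    rw [dist_self] at this
    linarith
  have : (insert x A).card ∈ S := by
    refine ⟨insert x A, rfl, ?_, ?_⟩
    · rw [Finset.coe_insert]
      exact insert_subset hx hAE
    · intro y hy z hz hyz
      rw [Finset.mem_insert] at hy hz
      rcases hy with rfl | hy <;> rcases hz with rfl | hz
      · exact absurd rfl hyz
      · exact hfar z hz
      · rw [dist_comm]; exact hfar y hy
      · exact hsep y hy z hz hyz
  have h5 := le_csSup hbdd this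
  rw [Finset.card_insert_of_notMem hxA, hcard] at h5
  omega

lemma ballCoveringNumber_le_card {X : Type*} [MetricSpace X] {E : Set X} {r : ℝ}
    {A : Finset X} (hA : (A : Set X) ⊆ E) (hcov : ∀ x ∈ E, ∃ y ∈ A, dist x y < r / 2) :
    ballCoveringNumber r E ≤ A.card := by
  refine Nat.sInf_le ⟨fun i => (A.equivFin.symm i : X), fun i => hA (A.equivFin.symm i).2, ?_⟩
  intro x hx
  obtain ⟨y, hy, hd⟩ := hcov x hx
  refine mem_iUnion.2 ⟨A.equivFin ⟨y, hy⟩, ?_⟩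
  simpa using hd

lemma exists_finset_card_le_ballCoveringNumber {X : Type*} [MetricSpace X] {E : Set X}
    (hE : TotallyBounded E) {r : ℝ} (hr : 0 < r) :
    ∃ A : Finset X, (A : Set X) ⊆ E ∧ A.card ≤ ballCoveringNumber r E ∧
      ∀ x ∈ E, ∃ y ∈ A, dist x y < r / 2 := by
  classical
  have hne : {n : ℕ | ∃ x : Fin n → X, (∀ i, x i ∈ E) ∧
      E ⊆ ⋃ i, Metric.ball (x i) (r / 2)}.Nonempty := by
    obtain ⟨A, hA, -, hcov⟩ := exists_separated_net hE (half_pos hr)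
    refine ⟨A.card, fun i => (A.equivFin.symm i : X), fun i => hA (A.equivFin.symm i).2, ?_⟩
    intro x hx
    obtain ⟨y, hy, hd⟩ := hcov x hx
    refine mem_iUnion.2 ⟨A.equivFin ⟨y, hy⟩, ?_⟩
    simpa using hd
  obtain ⟨x, hxE, hcov⟩ := Nat.sInf_mem hne
  refine ⟨Finset.univ.image x, ?_, ?_, ?_⟩
  · intro y hy
    simp only [Finset.coe_image, Finset.coe_univ, image_univ, mem_range] at hy
    obtain ⟨i, rfl⟩ := hy
    exact hxE i
  · refine Finset.card_image_le.trans ?_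
    simp [ballCoveringNumber]
  · intro y hy
    obtain ⟨i, hi⟩ := mem_iUnion.1 (hcov hy)
    exact ⟨x i, by simp, hi⟩

/-! ### Cost forced on every cover by the lower dimension. -/

/-- Every ball `B(x,R)` centred in `F` contains at least `q⁻ᵖ` balls of radius `qR` centred in `F`
whose centres are `4qR`-separated. -/
def SplitsAtRatio {X : Type*} [MetricSpace X] (F : Set X) (p q : ℝ) : Prop :=
  ∀ x ∈ F, ∀ R : ℝ, 0 < R → R ≤ Metric.diam F → ∃ A : Finset X, (A : Set X) ⊆ F ∧
    (∀ y ∈ A, Metric.ball y (q * R) ⊆ Metric.ball x R) ∧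
    (∀ y ∈ A, ∀ z ∈ A, y ≠ z → 4 * (q * R) ≤ dist y z) ∧ 1 ≤ (A.card : ℝ) * q ^ p

open Classical in
-- Induction on the number of scales between `R` and `σ`. Either one set meeting the ball has
-- diameter at least `q * R` and pays alone, or all are too small to meet two of the separated
-- sub-balls, and the costs of the at least `q⁻ᵖ` sub-balls add up.
lemma SplitsAtRatio.le_sum_diam_rpow {X : Type*} [MetricSpace X] {F : Set X} {p q σ : ℝ}
    (hsplit : SplitsAtRatio F p q) (hp : 0 ≤ p) (hq : 0 < q) (hq1 : q < 1)
    {𝒰 : Finset (Set X)} (hbdd : ∀ U ∈ 𝒰, Bornology.IsBounded U)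
    (hdiam : ∀ U ∈ 𝒰, σ ≤ Metric.diam U) (hcov : F ⊆ ⋃₀ (𝒰 : Set (Set X))) (n : ℕ) :
    ∀ x ∈ F, ∀ R : ℝ, 0 < R → R ≤ Metric.diam F → R * q ^ n ≤ σ →
      (q * R) ^ p ≤ ∑ U ∈ 𝒰 with (U ∩ Metric.ball x R).Nonempty, Metric.diam U ^ p := by
  have large : ∀ x ∈ F, ∀ R : ℝ, 0 < R → ∀ U ∈ 𝒰, (U ∩ Metric.ball x R).Nonempty →
      q * R ≤ Metric.diam U →
      (q * R) ^ p ≤ ∑ U ∈ 𝒰 with (U ∩ Metric.ball x R).Nonempty, Metric.diam U ^ p := by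
    intro x hx R hR U hU hUx hd
    refine (Real.rpow_le_rpow (by positivity) hd hp).trans ?_
    refine Finset.single_le_sum (f := fun U : Set X => Metric.diam U ^ p) (fun V _ => ?_)
      (Finset.mem_filter.2 ⟨hU, hUx⟩)
    exact Real.rpow_nonneg Metric.diam_nonneg _
  induction n with
  | zero =>
    intro x hx R hR hRF hRσ
    obtain ⟨U, hU, hxU⟩ := hcov hx
    refine large x hx R hR U hU ⟨x, hxU, Metric.mem_ball_self hR⟩ ?_
    have := hdiam U hU
    rw [pow_zero, mul_one] at hRσ
    nlinarith
  | succ n ih =>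
    intro x hx R hR hRF hRσ
    by_cases hbig : ∃ U ∈ 𝒰, (U ∩ Metric.ball x R).Nonempty ∧ q * R ≤ Metric.diam U
    · obtain ⟨U, hU, hUx, hd⟩ := hbig
      exact large x hx R hR U hU hUx hd
    push Not at hbig
    obtain ⟨A, hAF, hAsub, hAsep, hAcard⟩ := hsplit x hx R hR hRF
    have hqR : 0 < q * R := by positivity
    have hle : ∀ y ∈ A, (q * (q * R)) ^ p ≤
        ∑ U ∈ 𝒰 with (U ∩ Metric.ball y (q * R)).Nonempty, Metric.diam U ^ p := by
      intro y hy
      refine ih y (hAF hy) (q * R) hqR (by nlinarith) ?_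
      calc q * R * q ^ n = R * q ^ (n + 1) := by ring
        _ ≤ σ := hRσ
    -- Points of different sub-balls are more than `2 * (q * R)` apart, while sets meeting the ball
    -- have diameter below `q * R`.
    have hdisj : (A : Set X).PairwiseDisjoint
        (fun y => 𝒰.filter (fun U => (U ∩ Metric.ball y (q * R)).Nonempty)) := by
      intro y hy z hz hyz
      rw [Function.onFun, Finset.disjoint_left]
      intro U hUy hUz
      rw [Finset.mem_filter] at hUy hUz
      obtain ⟨hU, u, huU, hu⟩ := hUy
      obtain ⟨-, v, hvU, hv⟩ := hUz
      have h1 := hbig U hU ⟨u, huU, hAsub y hy hu⟩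
      have h2 := Metric.dist_le_diam_of_mem (hbdd U hU) huU hvU
      have h3 := hAsep y hy z hz hyz
      rw [Metric.mem_ball] at hu hv
      have h4 := dist_triangle4 y u v z
      rw [dist_comm y u] at h4
      linarith
    calc (q * R) ^ p = 1 * (q * R) ^ p := (one_mul _).symm
      _ ≤ (A.card : ℝ) * q ^ p * (q * R) ^ p := by gcongr
      _ = ∑ y ∈ A, (q * (q * R)) ^ p := by
        rw [Finset.sum_const, nsmul_eq_mul, Real.mul_rpow hq.le hqR.le, mul_assoc]
      _ ≤ ∑ y ∈ A, ∑ U ∈ 𝒰 with (U ∩ Metric.ball y (q * R)).Nonempty, Metric.diam U ^ p :=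
        Finset.sum_le_sum hle
      _ = ∑ U ∈ A.biUnion (fun y => 𝒰.filter
            (fun U => (U ∩ Metric.ball y (q * R)).Nonempty)), Metric.diam U ^ p :=
        (Finset.sum_biUnion hdisj).symm
      _ ≤ _ := by
        refine Finset.sum_le_sum_of_subset_of_nonneg ?_
          (fun U _ _ => Real.rpow_nonneg Metric.diam_nonneg _)
        intro U hU
        rw [Finset.mem_biUnion] at hU
        obtain ⟨y, hy, hU⟩ := hU
        rw [Finset.mem_filter] at hU ⊢
        obtain ⟨hU, u, huU, hu⟩ := hU
        exact ⟨hU, u, huU, hAsub y hy hu⟩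

open Classical in
lemma SplitsAtRatio.rpow_le_sum_diam_rpow {X : Type*} [MetricSpace X] {F : Set X} {p q σ : ℝ}
    (hsplit : SplitsAtRatio F p q) (hp : 0 ≤ p) (hq : 0 < q) (hq1 : q < 1) (hσ : 0 < σ)
    {𝒰 : Finset (Set X)} (hbdd : ∀ U ∈ 𝒰, Bornology.IsBounded U)
    (hdiam : ∀ U ∈ 𝒰, σ ≤ Metric.diam U) (hcov : F ⊆ ⋃₀ (𝒰 : Set (Set X)))
    {x : X} (hx : x ∈ F) {R : ℝ} (hR : 0 < R) (hRF : R ≤ Metric.diam F) :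
    (q * R) ^ p ≤ ∑ U ∈ 𝒰 with (U ∩ Metric.ball x R).Nonempty, Metric.diam U ^ p := by
  obtain ⟨n, hn⟩ := exists_pow_lt_of_lt_one (div_pos hσ hR) hq1
  refine hsplit.le_sum_diam_rpow hp hq hq1 hbdd hdiam hcov n x hx R hR hRF ?_
  rw [lt_div_iff₀ hR] at hn
  linarith

/-- Covers the case of lower dimension `0`, where no nonnegative `p` lies strictly below it. -/
lemma splitsAtRatio_zero {X : Type*} [MetricSpace X] (F : Set X) :
    SplitsAtRatio F 0 (1 / 2) := by
  intro x hx R hR _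
  refine ⟨{x}, by simpa using hx, ?_, ?_, by simp⟩
  · intro y hy
    rw [Finset.mem_singleton] at hy
    subst hy
    exact Metric.ball_subset_ball (by linarith)
  · intro y hy z hz hyz
    rw [Finset.mem_singleton] at hy hz
    exact absurd (hy.trans hz.symm) hyz

/-- A `4qR`-net of the half ball is also a cover counted by the covering number at scale `8qR`,
hence has at least `C * (1 / (16q)) ^ s` points. For small `q` the gap `s - p` absorbs the
constants. -/
lemma exists_splitsAtRatio_of_lt {X : Type*} [MetricSpace X] {F : Set X} (hF : TotallyBounded F)
    {p s C : ℝ} (hps : p < s) (hC : 0 < C)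
    (hlow : ∀ x ∈ F, ∀ r R : ℝ, 0 < r → r < R → R ≤ Metric.diam F →
      C * (R / r) ^ s ≤ (ballCoveringNumber r (Metric.ball x R ∩ F) : ℝ)) :
    ∃ q : ℝ, 0 < q ∧ q < 1 ∧ SplitsAtRatio F p q := by
  have hlim : Tendsto (fun q : ℝ => q ^ (s - p)) (𝓝[>] 0) (𝓝 0) := by
    have := (Real.continuousAt_rpow_const 0 (s - p) (Or.inr (by linarith))).tendsto
    rw [Real.zero_rpow (by linarith)] at this
    exact this.mono_left nhdsWithin_le_nhds
  have hK : 0 < C * (1 / 16) ^ s := by positivity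
  have hev : ∀ᶠ q : ℝ in 𝓝[>] 0, q ^ (s - p) < C * (1 / 16) ^ s ∧ q ∈ Ioo (0 : ℝ) (1 / 16) :=
    (hlim.eventually (gt_mem_nhds hK)).and (Ioo_mem_nhdsGT (by norm_num))
  obtain ⟨q, hqK, hq0, hq1⟩ := hev.exists
  refine ⟨q, hq0, by linarith, ?_⟩
  intro x hx R hR hRF
  have hqR : 0 < q * R := by positivity
  obtain ⟨A, hA, hsep, hcov⟩ := exists_separated_net (r := 4 * (q * R))
    (hF.subset (inter_subset_right (s := Metric.ball x (R / 2)) (t := F))) (by positivity)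
  refine ⟨A, fun y hy => (hA hy).2, ?_, hsep, ?_⟩
  · intro y hy
    refine Metric.ball_subset_ball' ?_
    have := (hA hy).1
    rw [Metric.mem_ball] at this
    nlinarith
  · have h1 := hlow x hx (8 * (q * R)) (R / 2) (by positivity) (by nlinarith) (by linarith)
    have h2 : ballCoveringNumber (8 * (q * R)) (Metric.ball x (R / 2) ∩ F) ≤ A.card := by
      refine ballCoveringNumber_le_card hA fun y hy => ?_
      obtain ⟨z, hz, hd⟩ := hcov y hy
      exact ⟨z, hz, by linarith⟩
    have h3 : R / 2 / (8 * (q * R)) = 1 / 16 * q⁻¹ := by field_simp; norm_num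
    rw [h3, Real.mul_rpow (by norm_num) (by positivity)] at h1
    have h4 : (1 : ℝ) = (q⁻¹) ^ s * q ^ p * q ^ (s - p) := by
      rw [Real.inv_rpow hq0.le, mul_assoc, ← Real.rpow_add hq0, add_sub_cancel,
        inv_mul_cancel₀ (by positivity)]
    have h5 : 0 < (q⁻¹) ^ s * q ^ p := by positivity
    calc (1 : ℝ) = (q⁻¹) ^ s * q ^ p * q ^ (s - p) := h4
      _ ≤ (q⁻¹) ^ s * q ^ p * (C * (1 / 16) ^ s) := by gcongr
      _ = (C * ((1 / 16) ^ s * q⁻¹ ^ s)) * q ^ p := by ring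
      _ ≤ _ := by
        gcongr
        exact h1.trans (by exact_mod_cast h2)

/-! ### Changing the range of diameters of a cover. -/

lemma exists_finset_cover_of_ballCoveringNumber_le {X : Type*} [MetricSpace X] {F : Set X}
    (hF : TotallyBounded F) {a C : ℝ}
    (hass : ∀ x ∈ F, ∀ r R : ℝ, 0 < r → r < R →
      (ballCoveringNumber r (Metric.ball x R ∩ F) : ℝ) ≤ C * (R / r) ^ a)
    {x : X} (hx : x ∈ F) {r u : ℝ} (hr : 0 < r) (hru : r < 4 * u) :
    ∃ B : Finset X, (B : Set X) ⊆ F ∧ (∀ y ∈ F, dist y x < 8 * u → ∃ z ∈ B, dist y z < r) ∧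
      (B.card : ℝ) ≤ C * 4 ^ a * (u / r) ^ a := by
  obtain ⟨B, hBF, hcard, hcov⟩ := exists_finset_card_le_ballCoveringNumber
    (hF.subset (inter_subset_right (s := Metric.ball x (8 * u)) (t := F)))
    (show 0 < 2 * r by positivity)
  refine ⟨B, fun y hy => (hBF hy).2, fun y hy hd => ?_, ?_⟩
  · obtain ⟨z, hz, hdz⟩ := hcov y ⟨hd, hy⟩
    exact ⟨z, hz, by linarith⟩
  · have h1 := hass x hx (2 * r) (8 * u) (by positivity) (by linarith)
    have hu : 0 < u := by linarith
    have h2 : 8 * u / (2 * r) = 4 * (u / r) := by field_simp; norm_num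
    rw [h2, Real.mul_rpow (by norm_num) (by positivity), ← mul_assoc] at h1
    exact le_trans (by exact_mod_cast hcard) h1

/-- Bounds the cost of replacing a set of diameter `u` by about `(u / r) ^ a` balls of radius `r`.
Since `t - a ≤ 0`, only a lower bound on `r` matters. -/
lemma div_rpow_mul_rpow_le {a s t u r rmax δ : ℝ} (hst : s ≤ t) (hta : t ≤ a) (hu : 0 < u)
    (huδ : u ≤ δ) (hrmax : 0 < rmax) (hrδ : rmax ≤ δ) (hr : min u rmax ≤ r) :
    (u / r) ^ a * r ^ t ≤ δ ^ (a - s) * rmax ^ (t - a) * u ^ s := by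
  have hm : 0 < min u rmax := lt_min hu hrmax
  have hr0 : 0 < r := hm.trans_le hr
  have h1 : (u / r) ^ a * r ^ t = u ^ (a - s) * r ^ (t - a) * u ^ s := by
    rw [Real.div_rpow hu.le hr0.le, Real.rpow_sub hu, Real.rpow_sub hr0]
    field_simp
  rw [h1]
  refine mul_le_mul_of_nonneg_right ?_ (by positivity)
  have h2 : r ^ (t - a) ≤ (min u rmax) ^ (t - a) :=
    Real.rpow_le_rpow_of_nonpos hm hr (by linarith)
  have hδ : 0 < δ := hu.trans_le huδ
  refine (mul_le_mul_of_nonneg_left h2 (by positivity)).trans ?_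
  rcases le_total u rmax with hur | hur
  · rw [min_eq_left hur, ← Real.rpow_add hu]
    calc u ^ (a - s + (t - a)) = u ^ (t - s) := by ring_nf
      _ ≤ δ ^ (t - s) := Real.rpow_le_rpow hu.le huδ (by linarith)
      _ = δ ^ (a - s) * δ ^ (t - a) := by rw [← Real.rpow_add hδ]; ring_nf
      _ ≤ _ := by
        refine mul_le_mul_of_nonneg_left ?_ (by positivity)
        exact Real.rpow_le_rpow_of_nonpos hrmax hrδ (by linarith)
  · rw [min_eq_right hur]
    refine mul_le_mul_of_nonneg_right ?_ (by positivity)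
    exact Real.rpow_le_rpow hu.le huδ (by linarith)

/-- A cover by sets with diameters in `[σ, δ]` can be replaced by a cover by balls with radii in
`[rmin, rmax]`: large sets are subdivided by means of the Assouad dimension, and the small sets are
merged into balls of radius `rmin`, whose number is controlled by the lower dimension. -/
lemma exists_ball_cover_of_cover {X : Type*} [MetricSpace X] {F : Set X} (hF : TotallyBounded F)
    {p q s t a C σ δ ε rmin rmax : ℝ} (hsplit : SplitsAtRatio F p q) (hp : 0 ≤ p) (hq : 0 < q)
    (hq1 : q < 1) (hps : p ≤ s) (hst : s ≤ t) (hta : t ≤ a) (hC : 0 < C)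
    (hass : ∀ x ∈ F, ∀ r R : ℝ, 0 < r → r < R →
      (ballCoveringNumber r (Metric.ball x R ∩ F) : ℝ) ≤ C * (R / r) ^ a)
    (hσ : 0 < σ) (hrmin : 0 < rmin) (hrr : rmin ≤ rmax) (hrδ : rmax ≤ δ)
    (hrF : rmin ≤ Metric.diam F)
    {𝒰 : Finset (Set X)} (hdiam : ∀ U ∈ 𝒰, σ ≤ Metric.diam U ∧ Metric.diam U ≤ δ)
    (hcov : F ⊆ ⋃₀ (𝒰 : Set (Set X))) (hcost : ∑ U ∈ 𝒰, Metric.diam U ^ s ≤ ε) :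
    ∃ B : Finset (X × ℝ), (∀ b ∈ B, b.1 ∈ F ∧ rmin ≤ b.2 ∧ b.2 ≤ rmax) ∧
      (∀ x ∈ F, ∃ b ∈ B, dist x b.1 < b.2) ∧
      ∑ b ∈ B, b.2 ^ t ≤ (C * 4 ^ a * (δ ^ (a - s) * rmax ^ (t - a)) +
        (q / 4) ^ (-p) * (rmin ^ (t - p) * σ ^ (p - s))) * ε := by
  classical
  have hrmax : 0 < rmax := hrmin.trans_le hrr
  have hbdd : ∀ U ∈ 𝒰, Bornology.IsBounded U := by
    intro U hU
    by_contra hunb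
    have h1 := (hdiam U hU).1
    rw [Metric.diam_eq_zero_of_unbounded hunb] at h1
    linarith
  obtain ⟨A, hAF, hAsep, hAcov⟩ := exists_separated_net hF hrmin
  set K₁ : ℝ := C * 4 ^ a * (δ ^ (a - s) * rmax ^ (t - a)) with hK₁
  have hδ : 0 < δ := hrmax.trans_le hrδ
  have hK₁0 : 0 ≤ K₁ := by positivity
  -- The diameter of `U` clamped to `[rmin, rmax]`.
  set r : Set X → ℝ := fun U => max rmin (min (Metric.diam U) rmax) with hr
  -- A large set takes charge of the whole `rmin`-balls around the net points near it. All of these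
  -- lie within `8 * diam U` of any one such net point.
  have hlarge : ∀ U ∈ 𝒰, rmin / 4 < Metric.diam U → ∃ B : Finset X, (B : Set X) ⊆ F ∧
      (∀ x ∈ A, (U ∩ Metric.ball x (rmin / 4)).Nonempty → ∀ y ∈ F, dist y x < rmin →
        ∃ z ∈ B, dist y z < r U) ∧
      (B.card : ℝ) * r U ^ t ≤ K₁ * Metric.diam U ^ s := by
    intro U hU hd
    have hu : 0 < Metric.diam U := by linarith
    by_cases hx₀ : ∃ x ∈ A, (U ∩ Metric.ball x (rmin / 4)).Nonempty
    · obtain ⟨x₀, hx₀A, v, hvU, hv⟩ := hx₀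
      have hr0 : 0 < r U := hrmin.trans_le (le_max_left _ _)
      have hru : r U < 4 * Metric.diam U :=
        max_lt (by linarith) ((min_le_left _ _).trans_lt (by linarith))
      obtain ⟨B, hBF, hBcov, hBcard⟩ :=
        exists_finset_cover_of_ballCoveringNumber_le hF hass (hAF hx₀A) hr0 hru
      refine ⟨B, hBF, ?_, ?_⟩
      · rintro x hx ⟨w, hwU, hw⟩ y hy hyx
        refine hBcov y hy ?_
        have h1 := Metric.dist_le_diam_of_mem (hbdd U hU) hwU hvU
        rw [Metric.mem_ball] at hv hw
        have h2 := dist_triangle4 y x w v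
        have h3 := dist_triangle y v x₀
        rw [dist_comm x w] at h2
        linarith
      · have h1 := div_rpow_mul_rpow_le hst hta hu (hdiam U hU).2 hrmax hrδ
          (le_max_right rmin (min (Metric.diam U) rmax))
        calc (B.card : ℝ) * r U ^ t ≤ C * 4 ^ a * (Metric.diam U / r U) ^ a * r U ^ t := by
              gcongr
          _ = C * 4 ^ a * ((Metric.diam U / r U) ^ a * r U ^ t) := by ring
          _ ≤ C * 4 ^ a * (δ ^ (a - s) * rmax ^ (t - a) * Metric.diam U ^ s) := by gcongr
          _ = _ := by rw [hK₁]; ring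
    · refine ⟨∅, by simp, fun x hx hxU => absurd ⟨x, hx, hxU⟩ hx₀, ?_⟩
      simp only [Finset.card_empty, Nat.cast_zero, zero_mul]
      positivity
  choose! BU hBUF hBUcov hBUcard using hlarge
  set L := 𝒰.filter (fun U => rmin / 4 < Metric.diam U) with hL
  set S := 𝒰.filter (fun U => ¬ rmin / 4 < Metric.diam U) with hS
  -- Around these net points only small sets do the covering. A small set cannot meet two of the
  -- quarter balls, so the forced `p`-costs add up and bound the number of bad points.
  set bad := A.filter (fun x => ∀ U ∈ L, ¬ (U ∩ Metric.ball x (rmin / 4)).Nonempty) with hbad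
  have hbadcard : (bad.card : ℝ) * rmin ^ t ≤ (q / 4) ^ (-p) * (rmin ^ (t - p) * σ ^ (p - s)) *
      ∑ U ∈ S, Metric.diam U ^ s := by
    have h1 : ∀ x ∈ bad, (q * (rmin / 4)) ^ p ≤
        ∑ U ∈ 𝒰 with (U ∩ Metric.ball x (rmin / 4)).Nonempty, Metric.diam U ^ p := by
      intro x hx
      exact hsplit.rpow_le_sum_diam_rpow hp hq hq1 hσ hbdd (fun U hU => (hdiam U hU).1) hcov
        (hAF (Finset.mem_filter.1 hx).1) (by positivity) (by linarith)
    have hdisj : (bad : Set X).PairwiseDisjoint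
        (fun x => 𝒰.filter (fun U => (U ∩ Metric.ball x (rmin / 4)).Nonempty)) := by
      intro y hy z hz hyz
      rw [Function.onFun, Finset.disjoint_left]
      intro U hUy hUz
      rw [Finset.mem_filter] at hUy hUz
      obtain ⟨hU, u, huU, hu⟩ := hUy
      obtain ⟨-, v, hvU, hv⟩ := hUz
      have hy' := Finset.mem_filter.1 (Finset.mem_coe.1 hy)
      have hz' := Finset.mem_filter.1 (Finset.mem_coe.1 hz)
      have h2 : Metric.diam U ≤ rmin / 4 := by
        by_contra! h
        exact hy'.2 U (Finset.mem_filter.2 ⟨hU, h⟩) ⟨u, huU, hu⟩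
      have h3 := Metric.dist_le_diam_of_mem (hbdd U hU) huU hvU
      have h4 := hAsep y hy'.1 z hz'.1 hyz
      rw [Metric.mem_ball] at hu hv
      have h5 := dist_triangle4 y u v z
      rw [dist_comm y u] at h5
      linarith
    have h6 : (bad.card : ℝ) * (q * (rmin / 4)) ^ p ≤ ∑ U ∈ S, Metric.diam U ^ p := by
      calc (bad.card : ℝ) * (q * (rmin / 4)) ^ p = ∑ x ∈ bad, (q * (rmin / 4)) ^ p := by
            rw [Finset.sum_const, nsmul_eq_mul]
        _ ≤ _ := Finset.sum_le_sum h1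
        _ = _ := (Finset.sum_biUnion hdisj).symm
        _ ≤ _ := by
          refine Finset.sum_le_sum_of_subset_of_nonneg ?_
            (fun U _ _ => Real.rpow_nonneg Metric.diam_nonneg _)
          intro U hU
          rw [Finset.mem_biUnion] at hU
          obtain ⟨x, hx, hU⟩ := hU
          rw [Finset.mem_filter] at hU hx
          rw [hS, Finset.mem_filter]
          exact ⟨hU.1, fun h => hx.2 U (Finset.mem_filter.2 ⟨hU.1, h⟩) hU.2⟩
    have h7 : ∑ U ∈ S, Metric.diam U ^ p ≤ σ ^ (p - s) * ∑ U ∈ S, Metric.diam U ^ s := by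
      rw [Finset.mul_sum]
      refine Finset.sum_le_sum fun U hU => ?_
      have hσU := (hdiam U (Finset.mem_filter.1 hU).1).1
      have hu : 0 < Metric.diam U := hσ.trans_le hσU
      calc Metric.diam U ^ p = Metric.diam U ^ (p - s) * Metric.diam U ^ s := by
            rw [← Real.rpow_add hu, sub_add_cancel]
        _ ≤ _ := mul_le_mul_of_nonneg_right
          (Real.rpow_le_rpow_of_nonpos hσ hσU (by linarith)) (by positivity)
    have h8 : rmin ^ t = (q / 4) ^ (-p) * rmin ^ (t - p) * (q * (rmin / 4)) ^ p := by
      have : q * (rmin / 4) = q / 4 * rmin := by ring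
      rw [this, Real.mul_rpow (by positivity) hrmin.le, Real.rpow_neg (by positivity),
        Real.rpow_sub hrmin]
      field_simp
    calc (bad.card : ℝ) * rmin ^ t =
          (q / 4) ^ (-p) * rmin ^ (t - p) * ((bad.card : ℝ) * (q * (rmin / 4)) ^ p) := by
          rw [h8]; ring
      _ ≤ (q / 4) ^ (-p) * rmin ^ (t - p) * (σ ^ (p - s) * ∑ U ∈ S, Metric.diam U ^ s) := by
          exact mul_le_mul_of_nonneg_left (h6.trans h7) (by positivity)
      _ = _ := by ring
  refine ⟨L.biUnion (fun U => (BU U).image (fun x => (x, r U))) ∪ bad.image (fun x => (x, rmin)),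
    ?_, ?_, ?_⟩
  · intro b hb
    simp only [Finset.mem_union, Finset.mem_biUnion, Finset.mem_image] at hb
    rcases hb with ⟨U, hU, x, hx, rfl⟩ | ⟨x, hx, rfl⟩
    · have hU' := Finset.mem_filter.1 hU
      exact ⟨hBUF U hU'.1 hU'.2 hx, le_max_left _ _, max_le hrr (min_le_right _ _)⟩
    · exact ⟨hAF (Finset.mem_filter.1 hx).1, le_rfl, hrr⟩
  · intro y hy
    obtain ⟨x, hx, hyx⟩ := hAcov y hy
    by_cases hxb : x ∈ bad
    · exact ⟨(x, rmin), Finset.mem_union_right _ (Finset.mem_image_of_mem _ hxb), hyx⟩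
    · have : ∃ U ∈ L, (U ∩ Metric.ball x (rmin / 4)).Nonempty := by
        by_contra! h
        refine hxb (Finset.mem_filter.2 ⟨hx, fun U hU => ?_⟩)
        rw [h U hU]
        exact Set.not_nonempty_empty
      obtain ⟨U, hU, hUx⟩ := this
      have hU' := Finset.mem_filter.1 hU
      obtain ⟨z, hz, hd⟩ := hBUcov U hU'.1 hU'.2 x hx hUx y hy hyx
      exact ⟨(z, r U), Finset.mem_union_left _ (Finset.mem_biUnion.2
        ⟨U, hU, Finset.mem_image_of_mem _ hz⟩), hd⟩
  · have hr0 : ∀ U, 0 < r U := fun U => hrmin.trans_le (le_max_left _ _)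
    -- The absolute value makes the summand nonnegative on all pairs, so sums over overlapping
    -- unions are subadditive.
    set g : X × ℝ → ℝ := fun b => |b.2| ^ t with hg
    have hg0 : ∀ b, 0 ≤ g b := fun b => Real.rpow_nonneg (abs_nonneg _) _
    have hbi : ∀ T : Finset (Set X), ∑ b ∈ T.biUnion (fun U => (BU U).image (fun x => (x, r U))),
        g b ≤ ∑ U ∈ T, (BU U).card * r U ^ t := by
      intro T
      induction T using Finset.induction_on with
      | empty => simp
      | insert U T hU ih =>
        rw [Finset.biUnion_insert, Finset.sum_insert hU]
        have h1 := Finset.sum_union_inter (s₁ := (BU U).image (fun x => (x, r U)))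
          (s₂ := T.biUnion (fun U => (BU U).image (fun x => (x, r U)))) (f := g)
        have h2 : 0 ≤ ∑ b ∈ (BU U).image (fun x => (x, r U)) ∩
          T.biUnion (fun U => (BU U).image (fun x => (x, r U))), g b :=
          Finset.sum_nonneg fun b _ => hg0 b
        have h3 : ∑ b ∈ (BU U).image (fun x => (x, r U)), g b = (BU U).card * r U ^ t := by
          rw [Finset.sum_image (fun x _ y _ h => congrArg Prod.fst h)]
          simp [hg, abs_of_pos (hr0 U)]
        linarith
    have hsum : ∀ B : Finset (X × ℝ), (∀ b ∈ B, 0 ≤ b.2) → ∑ b ∈ B, b.2 ^ t = ∑ b ∈ B, g b :=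
      fun B hB => Finset.sum_congr rfl fun b hb => by rw [hg]; simp only [abs_of_nonneg (hB b hb)]
    rw [hsum]
    swap
    · intro b hb
      simp only [Finset.mem_union, Finset.mem_biUnion, Finset.mem_image] at hb
      rcases hb with ⟨U, hU, x, hx, rfl⟩ | ⟨x, hx, rfl⟩
      · exact (hr0 U).le
      · exact hrmin.le
    have h1 := Finset.sum_union_inter
      (s₁ := L.biUnion (fun U => (BU U).image (fun x => (x, r U))))
      (s₂ := bad.image (fun x => (x, rmin))) (f := g)
    have h2 : 0 ≤ ∑ b ∈ L.biUnion (fun U => (BU U).image (fun x => (x, r U))) ∩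
        bad.image (fun x => (x, rmin)), g b := Finset.sum_nonneg fun b _ => hg0 b
    have h3 : ∑ b ∈ bad.image (fun x => (x, rmin)), g b = bad.card * rmin ^ t := by
      rw [Finset.sum_image (fun x _ y _ h => congrArg Prod.fst h)]
      simp [hg, abs_of_pos hrmin]
    have h4 : ∑ U ∈ L, ((BU U).card : ℝ) * r U ^ t ≤ K₁ * ∑ U ∈ L, Metric.diam U ^ s := by
      rw [Finset.mul_sum]
      refine Finset.sum_le_sum fun U hU => ?_
      have hU' := Finset.mem_filter.1 hU
      exact hBUcard U hU'.1 hU'.2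
    have hsub : ∀ T ⊆ 𝒰, ∑ U ∈ T, Metric.diam U ^ s ≤ ε := fun T hT =>
      (Finset.sum_le_sum_of_subset_of_nonneg hT
        (fun U _ _ => Real.rpow_nonneg Metric.diam_nonneg _)).trans hcost
    have h5 : K₁ * ∑ U ∈ L, Metric.diam U ^ s ≤ K₁ * ε :=
      mul_le_mul_of_nonneg_left (hsub L (Finset.filter_subset _ _)) hK₁0
    have h6 : (q / 4) ^ (-p) * (rmin ^ (t - p) * σ ^ (p - s)) * ∑ U ∈ S, Metric.diam U ^ s ≤
        (q / 4) ^ (-p) * (rmin ^ (t - p) * σ ^ (p - s)) * ε :=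
      mul_le_mul_of_nonneg_left (hsub S (Finset.filter_subset _ _)) (by positivity)
    have h7 := hbi L
    rw [add_mul]
    linarith

/-! ### Cheap covers, finite covers and ball covers. -/

/-- Every term of the finite cost is at least `(δ ^ (1 / θ)) ^ s > 0`, so there are finitely many.
-/
lemma HasCheapCover.exists_finset {X : Type*} [MetricSpace X] {F : Set X} {θ s δ ε : ℝ}
    (h : HasCheapCover F θ s δ ε) (hδ : 0 < δ) (hε : 0 ≤ ε) (hs : 0 ≤ s) :
    ∃ 𝒰 : Finset (Set X), F ⊆ ⋃₀ (𝒰 : Set (Set X)) ∧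
      (∀ U ∈ 𝒰, δ ^ (1 / θ) ≤ Metric.diam U ∧ Metric.diam U ≤ δ) ∧
      ∑ U ∈ 𝒰, Metric.diam U ^ s ≤ ε := by
  obtain ⟨𝒰, -, hcov, hdiam, hsum⟩ := h
  have hσ : 0 < δ ^ (1 / θ) := Real.rpow_pos_of_pos hδ _
  have hfin : 𝒰.Finite := by
    have h1 := ENNReal.finite_const_le_of_tsum_ne_top (ne_top_of_le_ne_top ENNReal.ofReal_ne_top hsum)
      (ε := ENNReal.ofReal ((δ ^ (1 / θ)) ^ s))
      (by rw [Ne, ENNReal.ofReal_eq_zero, not_le]; exact Real.rpow_pos_of_pos hσ _)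
    have h2 : {U : 𝒰 | ENNReal.ofReal ((δ ^ (1 / θ)) ^ s) ≤
        ENNReal.ofReal (Metric.diam (U : Set X) ^ s)} = univ := by
      refine eq_univ_of_forall fun U => ENNReal.ofReal_le_ofReal ?_
      exact Real.rpow_le_rpow hσ.le (hdiam U U.2).1 hs
    rw [h2] at h1
    exact Set.finite_coe_iff.1 (Set.finite_univ_iff.1 h1)
  refine ⟨hfin.toFinset, by simpa using hcov, fun U hU => hdiam U (by simpa using hU), ?_⟩
  have h3 : ∑' U : 𝒰, ENNReal.ofReal (Metric.diam (U : Set X) ^ s) =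
      ENNReal.ofReal (∑ U ∈ hfin.toFinset, Metric.diam U ^ s) := by
    rw [ENNReal.ofReal_sum_of_nonneg (fun U _ => Real.rpow_nonneg Metric.diam_nonneg _),
      ← Finset.tsum_subtype]
    have h4 : 𝒰 = {U | U ∈ hfin.toFinset} := by ext; simp
    exact tsum_congr_set_coe (fun U => ENNReal.ofReal (Metric.diam U ^ s)) h4
  rw [h3] at hsum
  exact (ENNReal.ofReal_le_ofReal_iff hε).1 hsum

lemma hasCheapCover_of_ball_cover {X : Type*} [MetricSpace X] {F : Set X} {c θ t δ M : ℝ} (ht : 0 ≤ t)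
    (hball : ∀ (x : X) (R : ℝ), 0 < R →
      ENNReal.ofReal R < Metric.ediam (univ : Set X) →
        (Metric.ball x R \ Metric.ball x (c * R)).Nonempty)
    (hδX : ENNReal.ofReal δ < Metric.ediam (univ : Set X)) {B : Finset (X × ℝ)}
    (hB : ∀ b ∈ B, 0 < b.2 ∧ δ ^ (1 / θ) ≤ c * b.2 ∧ 2 * b.2 ≤ δ)
    (hcov : ∀ x ∈ F, ∃ b ∈ B, dist x b.1 < b.2) (hsum : ∑ b ∈ B, b.2 ^ t ≤ M) :
    HasCheapCover F θ t δ (2 ^ t * M) := by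
  classical
  set f : X × ℝ → Set X := fun b => Metric.ball b.1 b.2 with hf
  have hup : ∀ b ∈ B, Metric.diam (f b) ≤ 2 * b.2 := fun b hb => Metric.diam_ball (hB b hb).1.le
  refine ⟨(B.image f : Finset (Set X)), Finset.countable_toSet _, ?_, ?_, ?_⟩
  · intro x hx
    obtain ⟨b, hb, hd⟩ := hcov x hx
    exact ⟨f b, by simpa using ⟨b.1, b.2, hb, rfl⟩, hd⟩
  · intro U hU
    rw [Finset.mem_coe, Finset.mem_image] at hU
    obtain ⟨b, hb, rfl⟩ := hU
    obtain ⟨h1, h2, h3⟩ := hB b hb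
    refine ⟨h2.trans ?_, (hup b hb).trans h3⟩
    obtain ⟨y, hy, hyc⟩ := hball b.1 b.2 h1
      ((ENNReal.ofReal_le_ofReal (by linarith)).trans_lt hδX)
    rw [Metric.mem_ball, not_lt] at hyc
    exact hyc.trans (Metric.dist_le_diam_of_mem Metric.isBounded_ball hy (Metric.mem_ball_self h1))
  · have h4 := Finset.tsum_subtype (B.image f) (fun U => ENNReal.ofReal (Metric.diam U ^ t))
    refine (le_of_eq h4).trans ?_
    rw [← ENNReal.ofReal_sum_of_nonneg (fun U _ => Real.rpow_nonneg Metric.diam_nonneg _)]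
    refine ENNReal.ofReal_le_ofReal ?_
    -- Different centre-radius pairs may give the same set, so only an inequality holds.
    have h5 : ∀ T ⊆ B, ∑ U ∈ T.image f, Metric.diam U ^ t ≤ ∑ b ∈ T, 2 ^ t * b.2 ^ t := by
      intro T
      induction T using Finset.induction_on with
      | empty => simp
      | insert b T hb ih =>
        intro hT
        have hbB : b ∈ B := hT (Finset.mem_insert_self _ _)
        have ih' := ih ((Finset.subset_insert _ _).trans hT)
        have h6 : Metric.diam (f b) ^ t ≤ 2 ^ t * b.2 ^ t := by
          rw [← Real.mul_rpow (by norm_num) (hB b hbB).1.le]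
          exact Real.rpow_le_rpow Metric.diam_nonneg (hup b hbB) ht
        have h7 : 0 ≤ Metric.diam (f b) ^ t := Real.rpow_nonneg Metric.diam_nonneg _
        rw [Finset.image_insert, Finset.sum_insert hb]
        by_cases hm : f b ∈ T.image f
        · rw [Finset.insert_eq_of_mem hm]
          linarith
        · rw [Finset.sum_insert hm]
          linarith
    refine (h5 B subset_rfl).trans ?_
    rw [← Finset.mul_sum]
    gcongr

lemma tendsto_rpow_nhdsGT_zero {β : ℝ} (hβ : 0 < β) :
    Tendsto (fun δ : ℝ => δ ^ β) (𝓝[>] 0) (𝓝[>] 0) := by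
  refine tendsto_nhdsWithin_iff.2 ⟨?_, ?_⟩
  · have := (Real.continuousAt_rpow_const 0 β (Or.inr hβ.le)).tendsto
    rw [Real.zero_rpow hβ.ne'] at this
    exact this.mono_left nhdsWithin_le_nhds
  · filter_upwards [self_mem_nhdsWithin] with δ hδ
    exact Real.rpow_pos_of_pos hδ _

/-- A cover at scale `δ` for the parameter `θ` and the exponent `s` yields a cover by balls at
scale `δ ^ ((a - s) / (a - t))` for the parameter `φ` and the exponent `t`. -/
lemma exists_ball_cover_of_hasCheapCover {X : Type*} [MetricSpace X] {F : Set X}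
    (hF : TotallyBounded F) (hF0 : 0 < Metric.diam F)
    {p q s t a C θ φ κ : ℝ} (hsplit : SplitsAtRatio F p q) (hp : 0 ≤ p) (hq : 0 < q)
    (hq1 : q < 1) (hps : p ≤ s) (hst : s ≤ t) (hta : t < a) (hC : 0 < C)
    (hass : ∀ x ∈ F, ∀ r R : ℝ, 0 < r → r < R →
      (ballCoveringNumber r (Metric.ball x R ∩ F) : ℝ) ≤ C * (R / r) ^ a)
    (hθ : 0 < θ) (hφ : 0 < φ) (hκ : 0 < κ)
    (hκφ : ∀ᶠ δ : ℝ in 𝓝[>] 0, κ * δ ^ (1 / φ) ≤ δ / 2)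
    (hexp : φ * (s - p) * (a - t) ≤ θ * (t - p) * (a - s)) :
    ∃ K : ℝ, 0 < K ∧ ∀ᶠ δ : ℝ in 𝓝[>] 0, ∀ ε : ℝ, 0 < ε → HasCheapCover F θ s δ ε →
      ∃ B : Finset (X × ℝ), (∀ b ∈ B, b.1 ∈ F ∧
          κ * (δ ^ ((a - s) / (a - t))) ^ (1 / φ) ≤ b.2 ∧
          b.2 ≤ δ ^ ((a - s) / (a - t)) / 2) ∧
        (∀ x ∈ F, ∃ b ∈ B, dist x b.1 < b.2) ∧ ∑ b ∈ B, b.2 ^ t ≤ K * ε := by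
  set β := (a - s) / (a - t) with hβ
  have hat : 0 < a - t := by linarith
  have hβ1 : 1 ≤ β := by rw [hβ, one_le_div hat]; linarith
  have hβ0 : 0 < β := by linarith
  have hβlim := tendsto_rpow_nhdsGT_zero hβ0
  have hφlim := tendsto_rpow_nhdsGT_zero (one_div_pos.2 hφ)
  have hsmall : ∀ᶠ δ : ℝ in 𝓝[>] 0, κ * (δ ^ β) ^ (1 / φ) ≤ Metric.diam F := by
    have h1 : Tendsto (fun δ : ℝ => κ * (δ ^ β) ^ (1 / φ)) (𝓝[>] 0) (𝓝 (κ * 0)) :=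
      ((hφlim.comp hβlim).mono_right nhdsWithin_le_nhds).const_mul κ
    rw [mul_zero] at h1
    filter_upwards [h1.eventually (gt_mem_nhds hF0)] with δ hδ using hδ.le
  refine ⟨C * 4 ^ a * 2 ^ (a - t) + (q / 4) ^ (-p) * κ ^ (t - p), by positivity, ?_⟩
  filter_upwards [hsmall, hβlim.eventually hκφ, Ioo_mem_nhdsGT (zero_lt_one' ℝ)]
    with δ h1 h2 hδ ε hε hcheap
  obtain ⟨hδ0, hδ1⟩ := hδ
  obtain ⟨𝒰, hcov, hdiam, hcost⟩ := hcheap.exists_finset hδ0 hε.le (hp.trans hps)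
  have hδβ : δ ^ β ≤ δ := by
    calc δ ^ β ≤ δ ^ (1 : ℝ) := Real.rpow_le_rpow_of_exponent_ge hδ0 hδ1.le hβ1
      _ = δ := Real.rpow_one δ
  have hδβ0 : 0 < δ ^ β := Real.rpow_pos_of_pos hδ0 _
  obtain ⟨B, hB, hBcov, hBsum⟩ := exists_ball_cover_of_cover hF hsplit hp hq hq1 hps hst hta.le hC
    hass (Real.rpow_pos_of_pos hδ0 (1 / θ)) (by positivity) h2 (by linarith) h1 hdiam hcov hcost
  refine ⟨B, hB, hBcov, hBsum.trans ?_⟩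
  refine mul_le_mul_of_nonneg_right ?_ hε.le
  -- The exponent `β` is chosen to cancel all powers of `δ` here.
  have h3 : δ ^ (a - s) * (δ ^ β / 2) ^ (t - a) = 2 ^ (a - t) := by
    rw [Real.div_rpow hδβ0.le (by norm_num), ← Real.rpow_mul hδ0.le, mul_div_assoc',
      ← Real.rpow_add hδ0]
    have : a - s + β * (t - a) = 0 := by rw [hβ]; field_simp; ring
    rw [this, Real.rpow_zero, one_div, ← Real.rpow_neg (by norm_num), neg_sub]
  have h4 : (κ * (δ ^ β) ^ (1 / φ)) ^ (t - p) * (δ ^ (1 / θ)) ^ (p - s) ≤ κ ^ (t - p) := by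
    rw [Real.mul_rpow hκ.le (by positivity), ← Real.rpow_mul hδ0.le, ← Real.rpow_mul hδ0.le,
      ← Real.rpow_mul hδ0.le, mul_assoc, ← Real.rpow_add hδ0]
    refine mul_le_of_le_one_right (by positivity) ?_
    refine Real.rpow_le_one hδ0.le hδ1.le ?_
    -- The remaining power of `δ`; it is nonnegative by `hexp`.
    have h5 : β * (1 / φ) * (t - p) + 1 / θ * (p - s) =
        (θ * (t - p) * (a - s) - φ * (s - p) * (a - t)) / (φ * θ * (a - t)) := by
      rw [hβ]; field_simp; ring
    rw [h5]
    exact div_nonneg (by linarith) (by positivity)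
  rw [h3]
  gcongr

lemma eventually_mul_rpow_le (κ : ℝ) {u η : ℝ} (hu : 1 < u) (hη : 0 < η) :
    ∀ᶠ δ : ℝ in 𝓝[>] 0, κ * δ ^ u ≤ η * δ := by
  have h1 : Tendsto (fun δ : ℝ => κ * δ ^ (u - 1)) (𝓝[>] 0) (𝓝 (κ * 0)) :=
    ((tendsto_rpow_nhdsGT_zero (sub_pos.2 hu)).mono_right nhdsWithin_le_nhds).const_mul κ
  rw [mul_zero] at h1
  filter_upwards [h1.eventually (gt_mem_nhds hη), self_mem_nhdsWithin] with δ h2 hδ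
  have hδ : 0 < δ := hδ
  calc κ * δ ^ u = κ * δ ^ (u - 1) * δ := by
        rw [mul_assoc, ← Real.rpow_add_one hδ.ne', sub_add_cancel]
    _ ≤ η * δ := by gcongr

lemma one_le_ballCoveringNumber {X : Type*} [MetricSpace X] {E : Set X} (hE : TotallyBounded E)
    (hne : E.Nonempty) {r : ℝ} (hr : 0 < r) : 1 ≤ ballCoveringNumber r E := by
  obtain ⟨A, -, hcard, hcov⟩ := exists_finset_card_le_ballCoveringNumber hE hr
  obtain ⟨x, hx⟩ := hne
  obtain ⟨y, hy, -⟩ := hcov x hx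
  exact (Finset.card_pos.2 ⟨y, hy⟩).trans_le hcard

lemma log_div_neg_log_le_iff {n : ℕ} (hn : 1 ≤ n) {δ : ℝ} (hδ : 0 < δ) (hδ1 : δ < 1) (t : ℝ) :
    Real.log n / (-Real.log δ) ≤ t ↔ (n : ℝ) * δ ^ t ≤ 1 := by
  have hlog : 0 < -Real.log δ := neg_pos.2 (Real.log_neg hδ hδ1)
  have hn0 : (0 : ℝ) < n := by exact_mod_cast hn
  have hδt : 0 < δ ^ t := Real.rpow_pos_of_pos hδ t
  rw [div_le_iff₀ hlog, ← Real.log_nonpos_iff (by positivity), Real.log_mul hn0.ne' hδt.ne',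
    Real.log_rpow hδ]
  constructor <;> intro h <;> linarith

lemma hasCheapCover_mono_left {X : Type*} [MetricSpace X] {F : Set X} {θ φ s δ ε : ℝ}
    (hθ : 0 < θ) (hθφ : θ ≤ φ) (hδ : 0 < δ) (hδ1 : δ ≤ 1) (h : HasCheapCover F φ s δ ε) :
    HasCheapCover F θ s δ ε := by
  obtain ⟨𝒰, hc, hcov, hdiam, hsum⟩ := h
  refine ⟨𝒰, hc, hcov, fun U hU => ⟨le_trans ?_ (hdiam U hU).1, (hdiam U hU).2⟩, hsum⟩
  exact Real.rpow_le_rpow_of_exponent_ge hδ hδ1 (one_div_le_one_div_of_le hθ hθφ)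

/-! ### A common treatment of both intermediate dimensions. -/

/-- The common features of the lower (`Q = ∃ᶠ`) and upper (`Q = ∀ᶠ`) intermediate dimensions. -/
structure IsIntermediateDim {X : Type*} [MetricSpace X] (F : Set X) (Q : (ℝ → Prop) → Prop)
    (H : ℝ → EReal) : Prop where
  mono : ∀ P P' : ℝ → Prop, (∀ᶠ δ in 𝓝[>] 0, P δ → P' δ) → Q P → Q P'
  of_eventually : ∀ P : ℝ → Prop, (∀ᶠ δ in 𝓝[>] 0, P δ) → Q P
  frequently : ∀ P : ℝ → Prop, Q P → ∃ᶠ δ in 𝓝[>] 0, P δ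
  rescale : ∀ (P : ℝ → Prop) (β : ℝ), 0 < β → Q (fun δ => P (δ ^ β)) → Q P
  eq_sInf : ∀ θ, θ ≠ 1 → H θ = sInf ((fun s : ℝ => (s : EReal)) ''
    {s : ℝ | 0 ≤ s ∧ ∀ ε : ℝ, 0 < ε → Q (fun δ => HasCheapCover F θ s δ ε)})
  one_le : ∀ t : ℝ, Q (fun δ => (ballCoveringNumber δ F : ℝ) * δ ^ t ≤ 1) → H 1 ≤ t
  of_one_lt : ∀ t : ℝ, H 1 < t → Q (fun δ => (ballCoveringNumber δ F : ℝ) * δ ^ t ≤ 1)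

lemma isIntermediateDim_lower {X : Type*} [MetricSpace X] {F : Set X} (hF : F.Nonempty)
    (hFtb : TotallyBounded F) :
    IsIntermediateDim F (fun P => ∃ᶠ δ in 𝓝[>] 0, P δ) (lowerIntermediateDim F) where
  mono P P' h hP := by
    refine (hP.and_eventually h).mono fun δ hδ => hδ.2 hδ.1
  of_eventually P hP := hP.frequently
  frequently P hP := hP
  rescale P β hβ hP := (tendsto_rpow_nhdsGT_zero hβ).frequently hP
  eq_sInf θ hθ := by
    rw [lowerIntermediateDim, if_neg hθ]
    congr 3
    ext s
    refine and_congr_right fun _ => forall_congr' fun ε => forall_congr' fun _ => ?_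
    rw [(nhdsGT_basis (0 : ℝ)).frequently_iff]
    constructor
    · intro h δ₀ hδ₀
      obtain ⟨δ, h1, h2, h3⟩ := h (min δ₀ 1) (lt_min hδ₀ one_pos) (min_le_right _ _)
      exact ⟨δ, ⟨h1, h2.trans_le (min_le_left _ _)⟩, h3⟩
    · intro h δ₀ hδ₀ _
      obtain ⟨δ, ⟨h1, h2⟩, h3⟩ := h δ₀ hδ₀
      exact ⟨δ, h1, h2, h3⟩
  one_le t ht := by
    rw [lowerIntermediateDim, if_pos rfl]
    refine liminf_le_of_frequently_le ((ht.and_eventually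
      (Ioo_mem_nhdsGT (zero_lt_one' ℝ))).mono fun δ hδ => ?_)
    exact EReal.coe_le_coe_iff.2 ((log_div_neg_log_le_iff
      (one_le_ballCoveringNumber hFtb hF hδ.2.1) hδ.2.1 hδ.2.2 t).2 hδ.1)
  of_one_lt t ht := by
    rw [lowerIntermediateDim, if_pos rfl] at ht
    refine ((frequently_lt_of_liminf_lt (by isBoundedDefault) ht).and_eventually
      (Ioo_mem_nhdsGT (zero_lt_one' ℝ))).mono fun δ hδ => ?_
    exact (log_div_neg_log_le_iff
      (one_le_ballCoveringNumber hFtb hF hδ.2.1) hδ.2.1 hδ.2.2 t).1 (EReal.coe_lt_coe_iff.1 hδ.1).le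

lemma isIntermediateDim_upper {X : Type*} [MetricSpace X] {F : Set X} (hF : F.Nonempty)
    (hFtb : TotallyBounded F) :
    IsIntermediateDim F (fun P => ∀ᶠ δ in 𝓝[>] 0, P δ) (upperIntermediateDim F) where
  mono P P' h hP := by
    filter_upwards [h, hP] with δ h1 h2 using h1 h2
  of_eventually P hP := hP
  frequently P hP := hP.frequently
  rescale P β hβ hP := by
    filter_upwards [(tendsto_rpow_nhdsGT_zero (inv_pos.2 hβ)).eventually hP, self_mem_nhdsWithin]
      with δ h1 hδ
    rwa [Real.rpow_inv_rpow (le_of_lt hδ) hβ.ne'] at h1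
  eq_sInf θ hθ := by
    rw [upperIntermediateDim, if_neg hθ]
    congr 3
    ext s
    refine and_congr_right fun _ => forall_congr' fun ε => forall_congr' fun _ => ?_
    rw [(nhdsGT_basis (0 : ℝ)).eventually_iff]
    constructor
    · rintro ⟨δ₀, h1, -, h2⟩
      exact ⟨δ₀, h1, fun δ hδ => h2 δ hδ.1 hδ.2⟩
    · rintro ⟨δ₀, h1, h2⟩
      exact ⟨min δ₀ 1, lt_min h1 one_pos, min_le_right _ _,
        fun δ hδ hδ' => h2 ⟨hδ, hδ'.trans_le (min_le_left _ _)⟩⟩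
  one_le t ht := by
    rw [upperIntermediateDim, if_pos rfl]
    refine limsup_le_of_le (by isBoundedDefault) ?_
    filter_upwards [ht, Ioo_mem_nhdsGT (zero_lt_one' ℝ)] with δ h1 hδ
    exact EReal.coe_le_coe_iff.2 ((log_div_neg_log_le_iff
      (one_le_ballCoveringNumber hFtb hF hδ.1) hδ.1 hδ.2 t).2 h1)
  of_one_lt t ht := by
    rw [upperIntermediateDim, if_pos rfl] at ht
    filter_upwards [eventually_lt_of_limsup_lt ht, Ioo_mem_nhdsGT (zero_lt_one' ℝ)] with δ h1 hδ
    exact (log_div_neg_log_le_iff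
      (one_le_ballCoveringNumber hFtb hF hδ.1) hδ.1 hδ.2 t).1 (EReal.coe_lt_coe_iff.1 h1).le

/-- With zero diameter the condition on scales is vacuous, and the supremum is infinite. -/
lemma diam_pos_of_lowerDim_eq {X : Type*} [MetricSpace X] {F : Set X} {lam : ℝ}
    (hlam : lowerDim F = (lam : EReal)) : 0 < Metric.diam F := by
  refine lt_of_le_of_ne Metric.diam_nonneg fun h0 => ?_
  have h1 : ((lam + 1 : ℝ) : EReal) ≤ lowerDim F := by
    refine le_sSup ⟨lam + 1, ⟨1, one_pos, fun x _ r R hr hrR hRF => ?_⟩, rfl⟩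
    linarith
  rw [hlam, EReal.coe_le_coe_iff] at h1
  linarith

lemma lowerDim_nonneg {X : Type*} [MetricSpace X] {F : Set X} (hFtb : TotallyBounded F) :
    0 ≤ lowerDim F := by
  refine le_sSup ⟨0, ⟨1, one_pos, fun x hx r R hr hrR _ => ?_⟩, rfl⟩
  rw [Real.rpow_zero, mul_one]
  exact_mod_cast one_le_ballCoveringNumber (hFtb.subset inter_subset_right)
    ⟨x, Metric.mem_ball_self (hr.trans hrR), hx⟩ hr

lemma exists_splitsAtRatio_of_lt_lowerDim {X : Type*} [MetricSpace X] {F : Set X}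
    (hFtb : TotallyBounded F) {p : ℝ} (hp : (p : EReal) < lowerDim F) :
    ∃ q : ℝ, 0 < q ∧ q < 1 ∧ SplitsAtRatio F p q := by
  obtain ⟨_, ⟨s, ⟨C, hC, hlow⟩, rfl⟩, hps⟩ := lt_sSup_iff.1 hp
  exact exists_splitsAtRatio_of_lt hFtb (EReal.coe_lt_coe_iff.1 hps) hC hlow

lemma exists_splitsAtRatio_near_lowerDim {X : Type*} [MetricSpace X] {F : Set X}
    (hFtb : TotallyBounded F) {lam : ℝ} (hlam : lowerDim F = (lam : EReal)) {η : ℝ} (hη : 0 < η) :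
    ∃ p q : ℝ, 0 ≤ p ∧ lam - η < p ∧ p ≤ lam ∧ 0 < q ∧ q < 1 ∧ SplitsAtRatio F p q := by
  have h0 := lowerDim_nonneg hFtb
  rw [hlam, EReal.coe_nonneg] at h0
  rcases h0.eq_or_lt with h0 | h0
  · exact ⟨0, 1 / 2, le_rfl, by linarith, h0.le, by norm_num, by norm_num, splitsAtRatio_zero F⟩
  · have hlt : max 0 (lam - η / 2) < lam := max_lt h0 (by linarith)
    obtain ⟨q, hq, hq1, hsplit⟩ := exists_splitsAtRatio_of_lt_lowerDim hFtb
      (p := max 0 (lam - η / 2)) (by rw [hlam]; exact EReal.coe_lt_coe_iff.2 hlt)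
    exact ⟨_, q, le_max_left _ _, lt_of_lt_of_le (by linarith) (le_max_right _ _), hlt.le,
      hq, hq1, hsplit⟩

lemma exists_assouad_bound {X : Type*} [MetricSpace X] {F : Set X} {t : ℝ}
    (ht : assouadDim F < t) : ∃ a C : ℝ, assouadDim F ≤ a ∧ a < t ∧ 0 < C ∧
      ∀ x ∈ F, ∀ r R : ℝ, 0 < r → r < R →
        (ballCoveringNumber r (Metric.ball x R ∩ F) : ℝ) ≤ C * (R / r) ^ a := by
  obtain ⟨_, ⟨a, ha, rfl⟩, hat⟩ := sInf_lt_iff.1 ht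
  obtain ⟨C, hC, hass⟩ := ha
  exact ⟨a, C, sInf_le ⟨a, ⟨C, hC, hass⟩, rfl⟩, EReal.coe_lt_coe_iff.1 hat, hC, hass⟩

lemma eventually_ofReal_lt_ediam_univ {X : Type*} [MetricSpace X] [Nontrivial X] :
    ∀ᶠ δ : ℝ in 𝓝[>] 0, ENNReal.ofReal δ < Metric.ediam (univ : Set X) := by
  obtain ⟨x, y, hxy⟩ := exists_pair_ne X
  filter_upwards [Ioo_mem_nhdsGT (dist_pos.2 hxy)] with δ hδ
  calc ENNReal.ofReal δ < ENNReal.ofReal (dist x y) :=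
        (ENNReal.ofReal_lt_ofReal_iff (dist_pos.2 hxy)).2 hδ.2
    _ = edist x y := (edist_dist x y).symm
    _ ≤ _ := Metric.edist_le_ediam_of_mem (mem_univ x) (mem_univ y)

/-! ### Monotonicity, bounds by the lower and Assouad dimensions, transfer of exponents. -/

namespace IsIntermediateDim

variable {X : Type*} [MetricSpace X] {F : Set X} {Q : (ℝ → Prop) → Prop} {H : ℝ → EReal}

lemma le_of_forall_hasCheapCover (hH : IsIntermediateDim F Q H) {θ s : ℝ} (hθ : θ ≠ 1) (hs : 0 ≤ s)
    (h : ∀ ε : ℝ, 0 < ε → Q (fun δ => HasCheapCover F θ s δ ε)) : H θ ≤ s := by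
  rw [hH.eq_sInf θ hθ]
  exact sInf_le ⟨s, ⟨hs, h⟩, rfl⟩

lemma exists_hasCheapCover_of_lt (hH : IsIntermediateDim F Q H) {θ t : ℝ} (hθ : θ ≠ 1)
    (ht : H θ < t) : ∃ s : ℝ, H θ ≤ s ∧ s < t ∧ 0 ≤ s ∧
      ∀ ε : ℝ, 0 < ε → Q (fun δ => HasCheapCover F θ s δ ε) := by
  have ht' := ht
  rw [hH.eq_sInf θ hθ] at ht'
  obtain ⟨_, ⟨s, ⟨hs, h⟩, rfl⟩, hst⟩ := sInf_lt_iff.1 ht'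
  exact ⟨s, hH.le_of_forall_hasCheapCover hθ hs h, EReal.coe_lt_coe_iff.1 hst, hs, h⟩

lemma le_one [Nontrivial X] (hH : IsIntermediateDim F Q H) (hX : IsUniformlyPerfect X)
    (hF : F.Nonempty) (hFtb : TotallyBounded F) {θ : ℝ} (hθ : 0 < θ) (hθ1 : θ < 1) :
    H θ ≤ H 1 := by
  obtain ⟨c, hc, hc1, hball⟩ := hX
  refine EReal.le_of_forall_lt_iff_le.1 fun t ht => ?_
  obtain ⟨u, hu, hut⟩ := EReal.lt_iff_exists_real_btwn.1 ht
  have hut : u < t := EReal.coe_lt_coe_iff.1 hut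
  have hQ := hH.of_one_lt u hu
  -- Covering numbers are at least `1`; the exponents admitted for `θ < 1` must be nonnegative.
  have hu0 : 0 ≤ u := by
    by_contra! hneg
    obtain ⟨δ, h1, hδ0, hδ1⟩ := ((hH.frequently _ hQ).and_eventually
      (Ioo_mem_nhdsGT (zero_lt_one' ℝ))).exists
    have h2 : 1 < δ ^ u := Real.one_lt_rpow_of_pos_of_lt_one_of_neg hδ0 hδ1 hneg
    have h3 : (1 : ℝ) ≤ ballCoveringNumber δ F := by
      exact_mod_cast one_le_ballCoveringNumber hFtb hF hδ0
    nlinarith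
  have ht0 : 0 ≤ t := by linarith
  refine hH.le_of_forall_hasCheapCover hθ1.ne ht0 fun ε hε => ?_
  refine hH.mono _ _ ?_ hQ
  have h1 : Tendsto (fun δ : ℝ => δ ^ (t - u)) (𝓝[>] 0) (𝓝 0) :=
    (tendsto_rpow_nhdsGT_zero (sub_pos.2 hut)).mono_right nhdsWithin_le_nhds
  filter_upwards [h1.eventually (gt_mem_nhds hε), self_mem_nhdsWithin,
    eventually_mul_rpow_le 1 ((one_lt_div hθ).2 hθ1) (half_pos hc),
    eventually_ofReal_lt_ediam_univ (X := X)] with δ h2 hδ h3 h4 h5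
  have hδ : 0 < δ := hδ
  classical
  obtain ⟨A, hAF, hcard, hcov⟩ := exists_finset_card_le_ballCoveringNumber hFtb hδ
  have hinj : Set.InjOn (fun x : X => (x, δ / 2)) A := fun x _ y _ h => congrArg Prod.fst h
  have h6 := hasCheapCover_of_ball_cover (F := F) (θ := θ) (t := t) (M := A.card * (δ / 2) ^ t)
    ht0 hball h4 (B := A.image (fun x => (x, δ / 2))) ?_ ?_ ?_
  · obtain ⟨𝒰, g1, g2, g3, g4⟩ := h6
    refine ⟨𝒰, g1, g2, g3, g4.trans (ENNReal.ofReal_le_ofReal ?_)⟩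
    have h7 : (A.card : ℝ) ≤ ballCoveringNumber δ F := by exact_mod_cast hcard
    calc 2 ^ t * (A.card * (δ / 2) ^ t) = A.card * δ ^ t := by
          rw [Real.div_rpow hδ.le (by norm_num)]; field_simp
      _ ≤ ballCoveringNumber δ F * δ ^ t := by gcongr
      _ = ballCoveringNumber δ F * δ ^ u * δ ^ (t - u) := by
          rw [mul_assoc, ← Real.rpow_add hδ, add_sub_cancel]
      _ ≤ 1 * δ ^ (t - u) := by gcongr
      _ ≤ ε := by linarith
  · intro b hb
    obtain ⟨x, hx, rfl⟩ := Finset.mem_image.1 hb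
    exact ⟨half_pos hδ, by simp only; linarith, by simp only; linarith⟩
  · intro x hx
    obtain ⟨y, hy, hd⟩ := hcov x hx
    exact ⟨(y, δ / 2), Finset.mem_image_of_mem _ hy, hd⟩
  · rw [Finset.sum_image hinj]
    simp

lemma monotone_of_le [Nontrivial X] (hH : IsIntermediateDim F Q H) (hX : IsUniformlyPerfect X)
    (hF : F.Nonempty) (hFtb : TotallyBounded F) {θ φ : ℝ} (hθ : 0 < θ) (hθφ : θ ≤ φ)
    (hφ : φ ≤ 1) : H θ ≤ H φ := by
  rcases hθφ.eq_or_lt with rfl | hlt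
  · exact le_rfl
  rcases hφ.eq_or_lt with rfl | hφ1
  · exact hH.le_one hX hF hFtb hθ hlt
  · rw [hH.eq_sInf θ (hlt.trans hφ1).ne, hH.eq_sInf φ hφ1.ne]
    refine sInf_le_sInf (image_mono ?_)
    rintro s ⟨hs, h⟩
    refine ⟨hs, fun ε hε => hH.mono _ _ ?_ (h ε hε)⟩
    filter_upwards [Ioo_mem_nhdsGT (zero_lt_one' ℝ)] with δ hδ hc
    exact hasCheapCover_mono_left hθ hθφ hδ.1 hδ.2.le hc

/-- For `s < p` below the lower dimension, the `s`-cost of a cover by sets of diameter at most `1`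
dominates its `p`-cost, which is at least `(q * diam F) ^ p`. -/
lemma lowerDim_le (hH : IsIntermediateDim F Q H) (hF : F.Nonempty) (hFtb : TotallyBounded F)
    (hF0 : 0 < Metric.diam F) {θ : ℝ} (hθ1 : θ ≠ 1) : lowerDim F ≤ H θ := by
  classical
  rw [hH.eq_sInf θ hθ1]
  refine le_sInf ?_
  rintro _ ⟨s, ⟨hs, h⟩, rfl⟩
  by_contra! hlt
  obtain ⟨p, hsp, hp⟩ := EReal.lt_iff_exists_real_btwn.1 hlt
  have hsp : s < p := EReal.coe_lt_coe_iff.1 hsp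
  obtain ⟨q, hq, hq1, hsplit⟩ := exists_splitsAtRatio_of_lt_lowerDim hFtb hp
  obtain ⟨x, hx⟩ := hF
  have hpos : 0 < (q * Metric.diam F) ^ p := by positivity
  obtain ⟨δ, h1, hδ0, hδ1⟩ := ((hH.frequently _ (h _ (half_pos hpos))).and_eventually
      (Ioo_mem_nhdsGT (zero_lt_one' ℝ))).exists
  obtain ⟨𝒰, hcov, hdiam, hcost⟩ := h1.exists_finset hδ0 (half_pos hpos).le hs
  have hσ : 0 < δ ^ (1 / θ) := Real.rpow_pos_of_pos hδ0 _
  have hbdd : ∀ U ∈ 𝒰, Bornology.IsBounded U := by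
    intro U hU
    by_contra hunb
    have h1 := (hdiam U hU).1
    rw [Metric.diam_eq_zero_of_unbounded hunb] at h1
    linarith
  have h2 := hsplit.rpow_le_sum_diam_rpow (hs.trans hsp.le) hq hq1 hσ hbdd
    (fun U hU => (hdiam U hU).1) hcov hx hF0 le_rfl
  have h3 : ∑ U ∈ 𝒰 with (U ∩ Metric.ball x (Metric.diam F)).Nonempty, Metric.diam U ^ p ≤
      ∑ U ∈ 𝒰, Metric.diam U ^ p :=
    Finset.sum_le_sum_of_subset_of_nonneg (Finset.filter_subset _ _)
      (fun U _ _ => Real.rpow_nonneg Metric.diam_nonneg _)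
  have h4 : ∑ U ∈ 𝒰, Metric.diam U ^ p ≤ ∑ U ∈ 𝒰, Metric.diam U ^ s := by
    refine Finset.sum_le_sum fun U hU => ?_
    obtain ⟨h5, h6⟩ := hdiam U hU
    exact Real.rpow_le_rpow_of_exponent_ge (hσ.trans_le h5) (h6.trans hδ1.le) hsp.le
  linarith

lemma one_le_assouadDim (hH : IsIntermediateDim F Q H) (hF : F.Nonempty)
    (hFtb : TotallyBounded F) : H 1 ≤ assouadDim F := by
  refine EReal.le_of_forall_lt_iff_le.1 fun t ht => ?_
  obtain ⟨a, C, -, hat, hC, hass⟩ := exists_assouad_bound ht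
  refine hH.one_le t (hH.of_eventually _ ?_)
  obtain ⟨x, hx⟩ := hF
  obtain ⟨R, hR⟩ := hFtb.isBounded.subset_ball x
  have hR0 : 0 < R := by
    have := hR hx
    rwa [Metric.mem_ball, dist_self] at this
  have h1 : Tendsto (fun δ : ℝ => C * R ^ a * δ ^ (t - a)) (𝓝[>] 0) (𝓝 (C * R ^ a * 0)) :=
    ((tendsto_rpow_nhdsGT_zero (sub_pos.2 hat)).mono_right nhdsWithin_le_nhds).const_mul _
  rw [mul_zero] at h1
  filter_upwards [h1.eventually (gt_mem_nhds one_pos), Ioo_mem_nhdsGT hR0] with δ h2 hδ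
  have h3 := hass x hx δ R hδ.1 hδ.2
  rw [inter_eq_right.2 hR, Real.div_rpow hR0.le hδ.1.le] at h3
  have hδ0 : 0 < δ := hδ.1
  calc (ballCoveringNumber δ F : ℝ) * δ ^ t ≤ C * (R ^ a / δ ^ a) * δ ^ t := by gcongr
    _ = C * R ^ a * δ ^ (t - a) := by rw [Real.rpow_sub hδ0]; ring
    _ ≤ 1 := h2.le

lemma le_of_exponents [Nontrivial X] (hH : IsIntermediateDim F Q H) (hX : IsUniformlyPerfect X)
    (hFtb : TotallyBounded F) (hF0 : 0 < Metric.diam F)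
    {p q s t a C θ φ : ℝ} (hsplit : SplitsAtRatio F p q) (hp : 0 ≤ p) (hq : 0 < q)
    (hq1 : q < 1) (hps : p ≤ s) (hst : s ≤ t) (hta : t < a) (hC : 0 < C)
    (hass : ∀ x ∈ F, ∀ r R : ℝ, 0 < r → r < R →
      (ballCoveringNumber r (Metric.ball x R ∩ F) : ℝ) ≤ C * (R / r) ^ a)
    (hθ : 0 < θ) (hφ : 0 < φ) (hφ1 : φ ≤ 1)
    (hexp : φ * (s - p) * (a - t) ≤ θ * (t - p) * (a - s))
    (hs : ∀ ε : ℝ, 0 < ε → Q (fun δ => HasCheapCover F θ s δ ε)) : H φ ≤ t := by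
  have hβ : 0 < (a - s) / (a - t) := div_pos (by linarith) (by linarith)
  have hβlim := tendsto_rpow_nhdsGT_zero hβ
  have ht0 : 0 ≤ t := by linarith
  rcases hφ1.eq_or_lt with rfl | hφ1
  · obtain ⟨K, hK, hev⟩ := exists_ball_cover_of_hasCheapCover hFtb hF0 hsplit hp hq hq1 hps hst hta
      -- At `φ = 1` this `κ` forces every radius to equal `δ' / 2`, so the cover is counted by the
      -- covering number.
      hC hass hθ hφ (κ := 1 / 2) (by norm_num)
      (Eventually.of_forall fun δ => by rw [div_one, Real.rpow_one]; linarith) hexp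
    refine hH.one_le t (hH.rescale _ _ hβ (hH.mono _ _ ?_
      (hs (K * 2 ^ t)⁻¹ (by positivity))))
    filter_upwards [hev, hβlim.eventually self_mem_nhdsWithin] with δ h1 hδ hc
    obtain ⟨B, hB, hcov, hsum⟩ := h1 _ (by positivity) hc
    set δ' := δ ^ ((a - s) / (a - t)) with hδ'
    have hδ : 0 < δ' := hδ
    have hrad : ∀ b ∈ B, b.2 = δ' / 2 := by
      intro b hb
      obtain ⟨-, h2, h3⟩ := hB b hb
      rw [div_one, Real.rpow_one] at h2
      linarith
    classical
    have h2 : ballCoveringNumber δ' F ≤ (B.image Prod.fst).card := by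
      refine ballCoveringNumber_le_card ?_ ?_
      · intro x hx
        rw [Finset.mem_coe, Finset.mem_image] at hx
        obtain ⟨b, hb, rfl⟩ := hx
        exact (hB b hb).1
      · intro x hx
        obtain ⟨b, hb, hd⟩ := hcov x hx
        exact ⟨b.1, Finset.mem_image_of_mem _ hb, by rw [hrad b hb] at hd; exact hd⟩
    have h3 : (ballCoveringNumber δ' F : ℝ) ≤ B.card := by
      exact_mod_cast h2.trans Finset.card_image_le
    rw [Finset.sum_congr rfl (fun b hb => by rw [hrad b hb]), Finset.sum_const, nsmul_eq_mul,
      Real.div_rpow hδ.le (by norm_num)] at hsum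
    calc (ballCoveringNumber δ' F : ℝ) * δ' ^ t ≤ B.card * δ' ^ t := by gcongr
      _ = B.card * (δ' ^ t / 2 ^ t) * 2 ^ t := by field_simp
      _ ≤ K * (K * 2 ^ t)⁻¹ * 2 ^ t := by gcongr
      _ = 1 := by field_simp
  · obtain ⟨c, hc, hc1, hball⟩ := hX
    obtain ⟨K, hK, hev⟩ := exists_ball_cover_of_hasCheapCover hFtb hF0 hsplit hp hq hq1 hps hst hta
      -- The factor `1 / c` compensates for the loss in the diameter of balls under uniform
      -- perfectness.
      hC hass hθ hφ (κ := 1 / c) (by positivity)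
      ((eventually_mul_rpow_le (1 / c) ((one_lt_div hφ).2 hφ1) one_half_pos).mono
        fun δ h => by linarith) hexp
    refine hH.le_of_forall_hasCheapCover hφ1.ne ht0 fun ε hε => ?_
    refine hH.rescale _ _ hβ (hH.mono _ _ ?_ (hs (ε / (2 ^ t * K)) (by positivity)))
    filter_upwards [hev, hβlim.eventually self_mem_nhdsWithin,
      hβlim.eventually (eventually_ofReal_lt_ediam_univ (X := X))] with δ h1 hδ hδX hc'
    obtain ⟨B, hB, hcov, hsum⟩ := h1 _ (by positivity) hc'
    set δ' := δ ^ ((a - s) / (a - t)) with hδ'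
    have hδ : 0 < δ' := hδ
    have h2 := hasCheapCover_of_ball_cover (θ := φ) ht0 hball hδX (B := B) ?_ hcov hsum
    · have h3 : 2 ^ t * (K * (ε / (2 ^ t * K))) = ε := by field_simp
      rwa [h3] at h2
    · intro b hb
      obtain ⟨-, h4, h5⟩ := hB b hb
      refine ⟨lt_of_lt_of_le (by positivity) h4, ?_, by linarith⟩
      rw [one_div_mul_eq_div, div_le_iff₀ hc] at h4
      linarith

end IsIntermediateDim

/-! ### The difference inequality and its consequences. -/

lemma IsIntermediateDim.le_add_of_eq_coe {X : Type*} [MetricSpace X] [Nontrivial X] {F : Set X}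
    {Q : (ℝ → Prop) → Prop} {H : ℝ → EReal} (hH : IsIntermediateDim F Q H)
    (hX : IsUniformlyPerfect X) (hFtb : TotallyBounded F) {lam alpha : ℝ}
    (hlam : lowerDim F = (lam : EReal)) (halpha : assouadDim F = (alpha : EReal))
    (hlt : lam < alpha) {θ φ : ℝ} (hθ : 0 < θ) (hθφ : θ < φ) (hφ : φ ≤ 1) {x y : ℝ}
    (hx : H θ = (x : EReal)) (hy : H φ = (y : EReal)) (hlx : lam ≤ x) (hxa : x ≤ alpha)
    (hya : y ≤ alpha) :
    y ≤ x + (x - lam) * (alpha - x) / (φ * (x - lam) + θ * (alpha - x)) * (φ - θ) := by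
  by_contra! hcon
  obtain ⟨t, ht, hty⟩ := exists_between hcon
  have hφ0 : 0 < φ := hθ.trans hθφ
  have hD : 0 < φ * (x - lam) + θ * (alpha - x) := by
    rcases hlx.eq_or_lt with h | h
    · have : 0 < alpha - x := by linarith
      have h2 : 0 ≤ x - lam := by linarith
      positivity
    · have : 0 < x - lam := by linarith
      have h2 : 0 ≤ alpha - x := by linarith
      positivity
  have hta : t < alpha := hty.trans_le hya
  have hxt : x < t := by
    refine lt_of_le_of_lt ?_ ht
    have h1 : 0 ≤ x - lam := by linarith
    have h2 : 0 ≤ alpha - x := by linarith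
    have h3 : 0 ≤ φ - θ := by linarith
    have : 0 ≤ (x - lam) * (alpha - x) / (φ * (x - lam) + θ * (alpha - x)) * (φ - θ) := by
      positivity
    linarith
  have hstrict : φ * (x - lam) * (alpha - t) < θ * (t - lam) * (alpha - x) := by
    have h1 : (x - lam) * (alpha - x) / (φ * (x - lam) + θ * (alpha - x)) * (φ - θ) < t - x := by
      linarith
    rw [div_mul_eq_mul_div, div_lt_iff₀ hD] at h1
    nlinarith
  -- The strict inequality is an open condition, so it survives replacing `lam`, `alpha`, `x` by
  -- nearby exponents `p`, `a`, `s` for which actual bounds and covers exist.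
  set g : ℝ × ℝ × ℝ → ℝ := fun v =>
    θ * (t - v.1) * (v.2.1 - v.2.2) - φ * (v.2.2 - v.1) * (v.2.1 - t) with hg
  have hgc : Continuous g := by fun_prop
  have hg0 : 0 < g (lam, alpha, x) := by simp only [hg]; linarith
  obtain ⟨η, hη, hball⟩ := Metric.eventually_nhds_iff.1
    (hgc.continuousAt.eventually (lt_mem_nhds hg0))
  obtain ⟨p, q, hp, hlp, hpl, hq, hq1, hsplit⟩ :=
    exists_splitsAtRatio_near_lowerDim hFtb hlam hη
  obtain ⟨a, C, haa, haη, hC, hass⟩ := exists_assouad_bound (F := F) (t := alpha + η)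
    (by rw [halpha]; exact EReal.coe_lt_coe_iff.2 (by linarith))
  rw [halpha, EReal.coe_le_coe_iff] at haa
  obtain ⟨s, hxs, hs, -, hcheap⟩ := hH.exists_hasCheapCover_of_lt (hθφ.trans_le hφ).ne
    (t := min t (x + η)) (by rw [hx]; exact EReal.coe_lt_coe_iff.2 (lt_min hxt (by linarith)))
  rw [hx, EReal.coe_le_coe_iff] at hxs
  have hst : s < t := hs.trans_le (min_le_left _ _)
  have hsη : s < x + η := hs.trans_le (min_le_right _ _)
  have hpos : 0 < g (p, a, s) := by
    refine hball ?_
    simp only [Prod.dist_eq, Real.dist_eq, max_lt_iff, abs_lt]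
    refine ⟨⟨by linarith, by linarith⟩, ⟨by linarith, by linarith⟩, by linarith, by linarith⟩
  simp only [hg] at hpos
  have h1 := hH.le_of_exponents hX hFtb (diam_pos_of_lowerDim_eq hlam) hsplit hp hq hq1
    (by linarith) hst.le (hta.trans_le haa) hC hass hθ hφ0 hφ (by linarith) hcheap
  rw [hy, EReal.coe_le_coe_iff] at h1
  linarith

theorem IsIntermediateDim.lowerDim_le_and_le_assouadDim {X : Type*} [MetricSpace X] [Nontrivial X]
    {F : Set X} {Q : (ℝ → Prop) → Prop} {H : ℝ → EReal} (hH : IsIntermediateDim F Q H)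
    (hX : IsUniformlyPerfect X) (hF : F.Nonempty) (hFtb : TotallyBounded F)
    (hF0 : 0 < Metric.diam F) {t : ℝ} (ht : t ∈ Ioc (0 : ℝ) 1) :
    lowerDim F ≤ H t ∧ H t ≤ assouadDim F := by
  refine ⟨?_, (hH.monotone_of_le hX hF hFtb ht.1 ht.2 le_rfl).trans
    (hH.one_le_assouadDim hF hFtb)⟩
  rcases ht.2.eq_or_lt with rfl | ht1
  · exact (hH.lowerDim_le hF hFtb hF0 (θ := 1 / 2) (by norm_num)).trans
      (hH.le_one hX hF hFtb (by norm_num) (by norm_num))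
  · exact hH.lowerDim_le hF hFtb hF0 ht1.ne

/-- The denominator is at least `θ * (u + v)`, and `4uv ≤ (u + v)²`. -/
lemma mul_div_add_le_div_four {u v θ φ : ℝ} (hu : 0 ≤ u) (huv : 0 < u + v)
    (hθ : 0 < θ) (hθφ : θ ≤ φ) : u * v / (φ * u + θ * v) ≤ (u + v) / (4 * θ) := by
  have h1 : θ * (u + v) ≤ φ * u + θ * v := by nlinarith
  have h2 : 0 < θ * (u + v) := by positivity
  rw [div_le_div_iff₀ (h2.trans_le h1) (by positivity)]
  nlinarith [mul_nonneg hθ.le (sq_nonneg (u - v)),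
    mul_le_mul_of_nonneg_left h1 huv.le]

theorem mainTheorem7 {X : Type*} [MetricSpace X] [Nontrivial X] (hX : IsUniformlyPerfect X)
    (F : Set X) (hF : F.Nonempty) (hFtb : TotallyBounded F)
    (lam alpha : ℝ) (hlam : lowerDim F = (lam : EReal)) (halpha : assouadDim F = (alpha : EReal))
    (hlt : lam < alpha)
    (H : ℝ → EReal) (hH : H = lowerIntermediateDim F ∨ H = upperIntermediateDim F)
    (h : ℝ → ℝ) (hh : ∀ t, h t = (H t).toReal) :
    (∀ t ∈ Ioc (0 : ℝ) 1, (lam : EReal) ≤ H t ∧ H t ≤ (alpha : EReal)) ∧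
    (∀ θ φ : ℝ, 0 < θ → θ ≤ φ → φ ≤ 1 →
      h θ ≤ h φ ∧
      h φ ≤ h θ + (h θ - lam) * (alpha - h θ) / (φ * (h θ - lam) + θ * (alpha - h θ)) * (φ - θ)) ∧
    ContinuousOn h (Ioc 0 1) ∧
    (∀ θ : ℝ, 0 < θ → θ ≤ 1 →
      LipschitzOnWith (Real.toNNReal ((alpha - lam) / (4 * θ))) h (Icc θ 1)) ∧
    (∀ᵐ t ∂(volume.restrict (Ioo (0 : ℝ) 1)), DifferentiableAt ℝ h t) := by
  have hF0 : 0 < Metric.diam F := diam_pos_of_lowerDim_eq hlam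
  obtain ⟨Q, hQ⟩ : ∃ Q : (ℝ → Prop) → Prop, IsIntermediateDim F Q H := by
    rcases hH with rfl | rfl
    · exact ⟨_, isIntermediateDim_lower hF hFtb⟩
    · exact ⟨_, isIntermediateDim_upper hF hFtb⟩
  have hbounds : ∀ t ∈ Ioc (0 : ℝ) 1, (lam : EReal) ≤ H t ∧ H t ≤ (alpha : EReal) := by
    intro t ht
    rw [← hlam, ← halpha]
    exact hQ.lowerDim_le_and_le_assouadDim hX hF hFtb hF0 ht
  have hcoe : ∀ t ∈ Ioc (0 : ℝ) 1, H t = (h t : EReal) := by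
    intro t ht
    obtain ⟨h1, h2⟩ := hbounds t ht
    rw [hh, EReal.coe_toReal (ne_top_of_le_ne_top (EReal.coe_ne_top _) h2)
      (ne_bot_of_le_ne_bot (EReal.coe_ne_bot _) h1)]
  have hreal : ∀ t ∈ Ioc (0 : ℝ) 1, lam ≤ h t ∧ h t ≤ alpha := by
    intro t ht
    have := hbounds t ht
    rwa [hcoe t ht, EReal.coe_le_coe_iff, EReal.coe_le_coe_iff] at this
  have hmain : ∀ θ φ : ℝ, 0 < θ → θ ≤ φ → φ ≤ 1 → h θ ≤ h φ ∧
      h φ ≤ h θ + (h θ - lam) * (alpha - h θ) / (φ * (h θ - lam) + θ * (alpha - h θ)) * (φ - θ) := by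
    intro θ φ hθ hθφ hφ
    have hθm : θ ∈ Ioc (0 : ℝ) 1 := ⟨hθ, hθφ.trans hφ⟩
    have hφm : φ ∈ Ioc (0 : ℝ) 1 := ⟨hθ.trans_le hθφ, hφ⟩
    refine ⟨?_, ?_⟩
    · have := hQ.monotone_of_le hX hF hFtb hθ hθφ hφ
      rwa [hcoe θ hθm, hcoe φ hφm, EReal.coe_le_coe_iff] at this
    · rcases hθφ.eq_or_lt with rfl | hlt'
      · simp
      · exact hQ.le_add_of_eq_coe hX hFtb hlam halpha hlt hθ hlt' hφ (hcoe θ hθm) (hcoe φ hφm)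
          (hreal θ hθm).1 (hreal θ hθm).2 (hreal φ hφm).2
  have hlip : ∀ θ : ℝ, 0 < θ → θ ≤ 1 →
      LipschitzOnWith (Real.toNNReal ((alpha - lam) / (4 * θ))) h (Icc θ 1) := by
    intro θ hθ _
    have hK : 0 ≤ (alpha - lam) / (4 * θ) := div_nonneg (by linarith) (by positivity)
    refine LipschitzOnWith.of_le_add_mul _ fun y hy x hx => ?_
    rw [Real.coe_toNNReal _ hK]
    rcases le_total x y with hxy | hxy
    · have hx0 : 0 < x := hθ.trans_le hx.1
      have h1 := (hreal x ⟨hx0, hx.2⟩).1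
      have h3 := mul_div_add_le_div_four (v := alpha - h x) (sub_nonneg.2 h1)
        (by linarith) hx0 hxy
      have h4 : (h x - lam + (alpha - h x)) / (4 * x) ≤ (alpha - lam) / (4 * θ) := by
        rw [show h x - lam + (alpha - h x) = alpha - lam by ring]
        exact div_le_div_of_nonneg_left (by linarith) (by positivity) (by linarith [hx.1])
      rw [Real.dist_eq, abs_of_nonneg (sub_nonneg.2 hxy)]
      refine (hmain x y hx0 hxy hy.2).2.trans ?_
      exact add_le_add_right (mul_le_mul_of_nonneg_right (h3.trans h4) (sub_nonneg.2 hxy)) _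
    · have := (hmain y x (hθ.trans_le hy.1) hxy hx.2).1
      have h2 := mul_nonneg hK (dist_nonneg (x := y) (y := x))
      linarith
  refine ⟨hbounds, hmain, ?_, hlip, ?_⟩
  · intro t ht
    -- Starting at `t / 2` makes the Lipschitz interval a neighbourhood of `t` within `(0, 1]`.
    have h1 := (hlip (t / 2) (by linarith [ht.1]) (by linarith [ht.2])).continuousOn t
      ⟨by linarith [ht.1], ht.2⟩
    refine h1.mono_of_mem_nhdsWithin ?_
    refine mem_nhdsWithin.2 ⟨Ioi (t / 2), isOpen_Ioi, by simpa using ht.1, ?_⟩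
    rintro u ⟨hu, hu'⟩
    exact ⟨le_of_lt hu, hu'.2⟩
  · have hmono : MonotoneOn h (Ioo 0 1) := fun x hx y hy hxy => (hmain x y hx.1 hxy hy.2.le).1
    filter_upwards [hmono.ae_differentiableWithinAt measurableSet_Ioo,
      ae_restrict_mem measurableSet_Ioo] with t h1 ht
    exact h1.differentiableAt (isOpen_Ioo.mem_nhds ht)
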